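/- **Theorem ($\mathrm{C}_n$ Andrews transformation).** Let $K$ be a field and $q\in K$ nonzero and not a root of unity. For $a\in K$ write $(a)_k=(1-a)(1-aq)\cdots(1-aq^{k-1})$ for integers $k\geq 0$ and $(a)_{-k}=1/\big((1-aq^{-1})\cdots(1-aq^{-k})\big)$ for $k\geq 1$ (so that, for complex $|q|<1$, $(a)_k=(a)_\infty/(aq^k)_\infty$); in particular $1/(q)_{-k}=0$ for $k\geq 1$. Put $(a_1,a_2)_k=(a_1)_k(a_2)_k$. Let $m,n$ be nonnegative integers, let $\mathbb N=\{0,1,2,\dots\}$ and $N\in\mathbb N^n$, and let $x=(x_1,\dots,x_n)$ and $b_1,c_1,\dots,b_{m+1},c_{m+1}$ be nonzero elements of $K$ such that $q^kx_i\neq x_j$ for $i\neq j$, $k\geq 0$; $q^kx_ix_j\neq 1$ for all $i,j$ and $k\geq 0$; and $q^kx_i\neq b_\ell$, $q^kx_i\neq c_\ell$ for all $i,\ell$ and $1\leq k\leq N_i$. (For instance, $q$, the $x_i$, $b_\ell$ and $c_\ell$ may be independent indeterminates.) Let $$\Delta_{\mathrm C}(x)=\prod_{i=1}^n(1-x_i^2)\prod_{1\leq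 i<j\leq n}(x_i-x_j)(x_ix_j-1),$$ $xq^r=(x_1q^{r_1},\dots,x_nq^{r_n})$, $|r|=r_1+\cdots+r_n$, and for $r,s\in\mathbb N^n$ and $\tau\in\mathbb Z$ let $$f^{(\tau)}_{r,s}(x;q)=\prod_{i=1}^n\Big(x_i^{r_i}q^{\binom{r_i}{2}}\Big)^{\tau}\prod_{i,j=1}^n\frac{(qx_i/x_j)_{r_i-r_j}}{(qx_i/x_j)_{r_i-s_j}}.$$ Then $$\begin{aligned} &\sum_{\substack{r\in\mathbb N^n\\ 0\leq r_i\leq N_i}}\frac{\Delta_{\mathrm C}(xq^r)}{\Delta_{\mathrm C}(x)}\prod_{i=1}^n\Bigg[\prod_{\ell=1}^{m+1}\frac{(b_\ell x_i,c_\ell x_i)_{r_i}}{(qx_i/b_\ell,qx_i/c_\ell)_{r_i}}\Big(\frac{q}{b_\ell c_\ell}\Big)^{r_i}\prod_{j=1}^n\frac{(q^{-N_j}x_i/x_j,x_ix_j)_{r_i}}{(qx_i/x_j,q^{N_j+1}x_ix_j)_{r_i}}\,q^{N_jr_i}\Bigg]\\ &=\prod_{i,j=1}^n(qx_ix_j)_{N_i}\prod_{1\leq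 i<j\leq n}\frac{1}{(qx_ix_j)_{N_i+N_j}}\sum_{r^{(1)},\dots,r^{(m)}\in\mathbb N^n}\ \prod_{i,j=1}^n\frac{(qx_i/x_j)_{N_i}}{(qx_i/x_j)_{N_i-r^{(1)}_j}}\prod_{\ell=1}^m f^{(0)}_{r^{(\ell)},r^{(\ell+1)}}(x;q)\\ &\qquad\times\prod_{\ell=1}^{m+1}\Bigg[(q/b_\ell c_\ell)_{|r^{(\ell-1)}|-|r^{(\ell)}|}\Big(\frac{q}{b_\ell c_\ell}\Big)^{|r^{(\ell)}|}\prod_{i=1}^n\frac{(b_\ell x_i,c_\ell x_i)_{r^{(\ell)}_i}}{(qx_i/b_\ell,qx_i/c_\ell)_{r^{(\ell-1)}_i}}\Bigg], \end{aligned}$$ where $r^{(0)}:=N$ and $r^{(m+1)}:=0$. Only finitely many terms of the multisum are nonzero: a term is $0$ (also if another of its factors is undefined) unless $N_i\geq r^{(1)}_i\geq\cdots\geq r^{(m)}_i$ for all $i$. -/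

import Mathlib

/-- The `q`-shifted factorial `(a)_k = (a; q)_k` for an arbitrary integer `k`:
`(a)_n = (1 - a)(1 - a q) ⋯ (1 - a q^(n-1))` for `n ≥ 0` and
`(a)_{-n} = 1 / ((1 - a q^(-1)) ⋯ (1 - a q^(-n)))` for `n ≥ 1`.
This is the rational function of `a` given by `(a)_∞ / (a q^k)_∞`. A division by zero occurs
only if `k = -n < 0` and `a = q^j` with `1 ≤ j ≤ n`; then `1 / (a)_k` is `0` with the
conventions of a Lean field, which is its true value. -/
def qPoch {K : Type*} [Field K] (q a : K) : ℤ → K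
  | Int.ofNat n => ∏ k ∈ Finset.range n, (1 - a * q ^ k)
  | Int.negSucc n => (∏ k ∈ Finset.range (n + 1), (1 - a * q ^ (-((k : ℤ) + 1))))⁻¹

/-- The generalised Vandermonde product of type `C`:
`Δ_C(x) = ∏ i, (1 - x i ^ 2) * ∏ i < j, (x i - x j) * (x i * x j - 1)`. -/
def deltaC {K : Type*} [Field K] {n : ℕ} (x : Fin n → K) : K :=
  (∏ i, (1 - x i ^ 2)) * ∏ i, ∏ j ∈ Finset.Ioi i, (x i - x j) * (x i * x j - 1)

/-- The `q`-hypergeometric term `f_{r,s}^{(τ)}(x; q)`. -/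
def hypTerm {K : Type*} [Field K] {n : ℕ} (q : K) (x : Fin n → K) (τ : ℤ) (r s : Fin n → ℕ) : K :=
  (∏ i, (x i ^ r i * q ^ (r i).choose 2) ^ τ) *
    ∏ i, ∏ j, qPoch q (q * x i / x j) ((r i : ℤ) - r j) / qPoch q (q * x i / x j) ((r i : ℤ) - s j)

/-- `|r| = r_1 + ⋯ + r_n`. -/
def size {n : ℕ} (r : Fin n → ℕ) : ℕ := ∑ i, r i

/-- The sequence `(r^(0), r^(1), …, r^(m), r^(m+1))` with `r^(0) = N` and `r^(m+1) = 0`;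
here `r k` (`k : Fin m`, counted from `0`) is `r^(k+1)`. -/
def extendSeq {n m : ℕ} (N : Fin n → ℕ) (r : Fin m → Fin n → ℕ) : Fin (m + 2) → Fin n → ℕ :=
  Fin.cons (α := fun _ => Fin n → ℕ) N (Fin.snoc (α := fun _ => Fin n → ℕ) r 0)

/-- The left-hand side: the terminating very-well-poised `C_n` series.
`b l`, `c l` (`l : Fin (m + 1)`, counted from `0`) are the parameters `b_{l+1}`, `c_{l+1}`. -/
def andrewsLHS {K : Type*} [Field K] {n m : ℕ} (q : K) (x : Fin n → K) (b c : Fin (m + 1) → K)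
    (N : Fin n → ℕ) : K :=
  ∑ r ∈ Finset.Icc 0 N,
    deltaC (fun i => x i * q ^ r i) / deltaC x *
      ∏ i,
        ((∏ l, qPoch q (b l * x i) (r i) * qPoch q (c l * x i) (r i) /
              (qPoch q (q * x i / b l) (r i) * qPoch q (q * x i / c l) (r i)) *
              (q / (b l * c l)) ^ r i) *
          ∏ j, qPoch q (q ^ (-(N j : ℤ)) * x i / x j) (r i) * qPoch q (x i * x j) (r i) /
              (qPoch q (q * x i / x j) (r i) * qPoch q (q ^ (N j + 1) * x i * x j) (r i)) *
              q ^ (N j * r i))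

/-- The prefactor of the multisum on the right-hand side. -/
def andrewsPrefactor {K : Type*} [Field K] {n : ℕ} (q : K) (x : Fin n → K) (N : Fin n → ℕ) : K :=
  (∏ i, ∏ j, qPoch q (q * x i * x j) (N i)) *
    ∏ i, ∏ j ∈ Finset.Ioi i, 1 / qPoch q (q * x i * x j) ((N i : ℤ) + N j)

/-- The summand of the multisum on the right-hand side, for `r = (r^(1), …, r^(m))`. In the code
`R l.castSucc = r^(l)` and `R l.succ = r^(l+1)` for `l = 0, …, m`. -/
def andrewsTerm {K : Type*} [Field K] {n m : ℕ} (q : K) (x : Fin n → K) (b c : Fin (m + 1) → K)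
    (N : Fin n → ℕ) (r : Fin m → Fin n → ℕ) : K :=
  let R := extendSeq N r
  (∏ i, ∏ j, qPoch q (q * x i / x j) (N i) / qPoch q (q * x i / x j) ((N i : ℤ) - R 1 j)) *
    (∏ l : Fin m, hypTerm q x 0 (R l.succ.castSucc) (R l.succ.succ)) *
    ∏ l : Fin (m + 1),
      (qPoch q (q / (b l * c l)) ((size (R l.castSucc) : ℤ) - size (R l.succ)) *
        (q / (b l * c l)) ^ size (R l.succ) *
        ∏ i, qPoch q (b l * x i) (R l.succ i) * qPoch q (c l * x i) (R l.succ i) /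
          (qPoch q (q * x i / b l) (R l.castSucc i) * qPoch q (q * x i / c l) (R l.castSucc i)))

/-! The transformation is an iterated Bailey lemma. Let `M(N,r) = invA N r * invC N r` be the Bailey
matrix, `w` the weight `baileyWeight` and `κ` the kernel `baileyKernel`, the last two depending on a
pair `b, c`. Two identities carry the proof: (1) `∑ s, κ(N,s) M(s,r) = w(r) M(N,r)`
(`sum_baileyKernel`): the kernel acts on the columns of `M` as a diagonal matrix; (2) `∑ r, α(r)
w(r) M(N,r) = κ(N,0)` (`sum_alphaSeq`), a `6φ5` summation. In a sum of products `κ₁(N,r¹) κ₂(r¹,r²)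
⋯ κ(rᵐ,0)`, expand the last kernel by (2) and absorb the others by (1). The result is `∑ s, α(s) ∏
w(s) M(N,s)`. The quotients of `invPairs` in the kernels telescope, which turns the kernel products
into the terms of the multisum; reversing `(q^{-N_j} x_i/x_j)_{r_i}` turns the single sum into the
left-hand side.

Both identities are proved by induction on `|N|` and interpolation in `b`. After multiplication by
`∏ b^{N_i} (q x_i/b)_{N_i}` both sides are polynomials in `b` of degree at most `|N|`, so `|N| + 1`
points suffice. At the `|N|` points `b = q^{-k}/x_p` with `k < N_p`, the factor `(b x_p)_{s_p}`
kills all terms with `s_p > k`. Up to a common nonzero factor, what remains is the same identity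
with `N_p` replaced by `k` and `b` by `q^{-N_p}/x_p`.

The last point differs. For (1) it is `b = q/c`, where `(q/bc)_{|N|-|s|}` leaves only `s = N`. For
(2) it is `b = q x_p` with `N_p > 0`: the cleared terms with `r_p = 0` vanish, and the others form
the same series with `x_p, N_p, r_p, b` replaced by `q x_p, N_p - 1, r_p - 1, x_p`. -/

/-- The `q`-shifted factorial `(a)_n` for a natural number `n`. -/
def qp {K : Type*} [Field K] (q a : K) (n : ℕ) : K := ∏ k ∈ Finset.range n, (1 - a * q ^ k)

/-! ### Shifted factorials with integer index, and their reciprocals -/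

section Pochhammer

variable {K : Type*} [Field K] {q a : K}

lemma qPoch_natCast (q a : K) (n : ℕ) : qPoch q a (n : ℤ) = qp q a n := rfl

@[simp] lemma qp_zero (q a : K) : qp q a 0 = 1 := by simp [qp]

lemma qp_succ (q a : K) (n : ℕ) : qp q a (n + 1) = qp q a n * (1 - a * q ^ n) :=
  Finset.prod_range_succ _ _

lemma qp_add (q a : K) (m n : ℕ) : qp q a (m + n) = qp q a m * qp q (a * q ^ m) n := by
  simp only [qp, Finset.prod_range_add, pow_add, mul_assoc]

lemma qp_succ' (q a : K) (n : ℕ) : qp q a (n + 1) = (1 - a) * qp q (a * q) n := by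
  rw [add_comm, qp_add]; simp [qp]

lemma qp_ne_zero {n : ℕ} (h : ∀ k < n, a * q ^ k ≠ 1) : qp q a n ≠ 0 :=
  Finset.prod_ne_zero_iff.2 fun k hk => sub_ne_zero.2 (h k (Finset.mem_range.1 hk)).symm

lemma qp_eq_zero {n k : ℕ} (hk : k < n) (h : a * q ^ k = 1) : qp q a n = 0 :=
  Finset.prod_eq_zero (Finset.mem_range.2 hk) (by rw [h, sub_self])

lemma qPoch_negSucc (q a : K) (n : ℕ) : (qPoch q a (Int.negSucc n))⁻¹ =
    ∏ k ∈ Finset.range (n + 1), (1 - a * q ^ (-((k : ℤ) + 1))) := by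
  simp [qPoch]

/-- `1 / (q)_k` vanishes for negative `k`. -/
lemma inv_qPoch_self_eq_zero (hq : q ≠ 0) {k : ℤ} (hk : k < 0) : (qPoch q q k)⁻¹ = 0 := by
  obtain ⟨n, rfl⟩ := Int.eq_negSucc_of_lt_zero hk
  rw [qPoch_negSucc]
  exact Finset.prod_eq_zero (Finset.mem_range.2 n.succ_pos) (by simp [hq])

/-- The reciprocal is the right object: for negative `k` it is a plain product, so the recurrence
also holds at its zeros, where `(a)_k` has a pole. -/
lemma inv_qPoch_succ (h : ∀ k : ℕ, a * q ^ k ≠ 1) (k : ℤ) :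
    (qPoch q a k)⁻¹ = (qPoch q a (k + 1))⁻¹ * (1 - a * q ^ k) := by
  rcases k with n | n
  · have := qp_succ q a n
    have h1 : 1 - a * q ^ n ≠ 0 := sub_ne_zero.2 (h n).symm
    have e : (Int.ofNat n + 1 : ℤ) = ((n + 1 : ℕ) : ℤ) := by simp
    rw [e, qPoch_natCast, this, Int.ofNat_eq_natCast, qPoch_natCast, zpow_natCast]
    field_simp
  · rw [qPoch_negSucc, Finset.prod_range_succ]
    have e2 : (Int.negSucc n : ℤ) = -((n : ℤ) + 1) := by simp [Int.negSucc_eq]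
    rw [e2]
    congr 1
    rcases n with _ | n
    · simp [qPoch]
    · have : (-(((n + 1 : ℕ) : ℤ) + 1) + 1) = Int.negSucc n := by
        rw [Int.negSucc_eq]; push_cast; ring
      rw [this, qPoch_negSucc]

lemma inv_qPoch_add (hq : q ≠ 0) (h : ∀ k : ℕ, a * q ^ k ≠ 1) (k : ℤ) (n : ℕ) :
    (qPoch q a k)⁻¹ = (qPoch q a (k + n))⁻¹ * qp q (a * q ^ k) n := by
  induction n with
  | zero => simp
  | succ n ih =>
    rw [ih, inv_qPoch_succ h (k + n), qp_succ, zpow_add₀ hq, zpow_natCast]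
    push_cast
    rw [add_assoc k]
    ring

lemma inv_qPoch_mul_left (hq : q ≠ 0) (h : a ≠ 1) (k : ℤ) :
    (qPoch q (a * q) k)⁻¹ = (qPoch q a (k + 1))⁻¹ * (1 - a) := by
  have h1 : 1 - a ≠ 0 := sub_ne_zero.2 h.symm
  rcases k with n | n
  · have e : (Int.ofNat n + 1 : ℤ) = ((n + 1 : ℕ) : ℤ) := by simp
    rw [e, Int.ofNat_eq_natCast, qPoch_natCast, qPoch_natCast, qp_succ']
    field_simp
  · rw [qPoch_negSucc, Finset.prod_range_succ']
    congr 1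
    · rcases n with _ | n
      · simp [qPoch]
      · have : (Int.negSucc (n + 1) + 1 : ℤ) = Int.negSucc n := by
          rw [Int.negSucc_eq, Int.negSucc_eq]; push_cast; ring
        rw [this, qPoch_negSucc]
        refine Finset.prod_congr rfl fun k _ => ?_
        rw [mul_assoc, ← zpow_one_add₀ hq]
        congr 3
    · simp [hq]

/-- Reversal of a `q`-shifted factorial. -/
lemma qp_reverse (hq : q ≠ 0) {y : K} (hy : y ≠ 0) (k r : ℕ) {b : K} (hb : b * q ^ k = y) :
    qp q b r * q ^ (k * r) =
      (-y) ^ r * q ^ r.choose 2 * qp q (q * y⁻¹ * q ^ ((k : ℤ) - r)) r := by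
  induction r with
  | zero => simp
  | succ r ih =>
    rw [qp_succ, qp_succ', Nat.choose_succ_succ' r 1, Nat.choose_one_right]
    have e : q * y⁻¹ * q ^ ((k : ℤ) - (r + 1 : ℕ)) * q = q * y⁻¹ * q ^ ((k : ℤ) - r) := by
      rw [mul_assoc, ← zpow_add_one₀ hq]; congr 2; push_cast; ring
    rw [e]
    have e2 : q * y⁻¹ * q ^ ((k : ℤ) - (r + 1 : ℕ)) = y⁻¹ * q ^ k / q ^ r := by
      rw [zpow_sub₀ hq, zpow_natCast, zpow_natCast, pow_succ]; field_simp
    rw [e2, pow_add, Nat.mul_succ, pow_add]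
    have e3 : (1 - b * q ^ r) * q ^ k = - y * q ^ r * (1 - y⁻¹ * q ^ k / q ^ r) := by
      field_simp; linear_combination (-q ^ r) * hb
    linear_combination (1 - b * q ^ r) * q ^ k * ih +
      (-y) ^ r * q ^ r.choose 2 * qp q (q * y⁻¹ * q ^ ((k : ℤ) - r)) r * e3

end Pochhammer

/-! ### Products over pairs of indices -/

section Products

variable {K : Type*} [Field K] {n : ℕ}

/-- A product over pairs `i < j` of a symmetric function that is trivial away from `p`. -/
lemma prod_Ioi_eq_prod_erase {f : Fin n → Fin n → K} (p : Fin n) (hsymm : ∀ i j, f i j = f j i)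
    (hone : ∀ i j, i ≠ p → j ≠ p → f i j = 1) :
    ∏ i, ∏ j ∈ Finset.Ioi i, f i j = ∏ j ∈ Finset.univ.erase p, f p j := by
  have h1 : ∀ i ∈ Finset.univ.erase p,
      ∏ j ∈ Finset.Ioi i, f i j = if i < p then f p i else 1 := by
    intro i hi
    have hip : i ≠ p := Finset.ne_of_mem_erase hi
    split_ifs with h
    · rw [Finset.prod_eq_single_of_mem p (Finset.mem_Ioi.2 h) fun j _ hj => hone i j hip hj,
        hsymm]
    · exact Finset.prod_eq_one fun j hj => hone i j hip fun e => h (e ▸ Finset.mem_Ioi.1 hj)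
  have h2 : ∏ j ∈ Finset.Ioi p, f p j =
      ∏ i ∈ Finset.univ.erase p, if i < p then 1 else f p i := by
    rw [Finset.prod_ite, Finset.prod_const_one, one_mul]
    refine Finset.prod_congr ?_ fun _ _ => rfl
    ext j
    simp only [Finset.mem_Ioi, Finset.mem_filter, Finset.mem_erase, Finset.mem_univ, and_true,
      not_lt]
    exact ⟨fun h => ⟨h.ne', h.le⟩, fun h => lt_of_le_of_ne h.2 (Ne.symm h.1)⟩
  rw [← Finset.mul_prod_erase _ _ (Finset.mem_univ p), Finset.prod_congr rfl h1, h2,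
    ← Finset.prod_mul_distrib]
  exact Finset.prod_congr rfl fun i _ => by split_ifs <;> simp

/-- Splitting a double product according to the occurrences of the index `p`. -/
lemma prod_prod_eq_mul_erase (f : Fin n → Fin n → K) (p : Fin n) :
    ∏ i, ∏ j, f i j = f p p * (∏ j ∈ Finset.univ.erase p, f p j * f j p) *
      ∏ i ∈ Finset.univ.erase p, ∏ j ∈ Finset.univ.erase p, f i j := by
  rw [← Finset.mul_prod_erase _ _ (Finset.mem_univ p),
    ← Finset.mul_prod_erase _ (f p) (Finset.mem_univ p), Finset.prod_mul_distrib]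
  have : ∀ i ∈ Finset.univ.erase p,
      ∏ j, f i j = f i p * ∏ j ∈ Finset.univ.erase p, f i j := fun i _ =>
    (Finset.mul_prod_erase _ (f i) (Finset.mem_univ p)).symm
  rw [Finset.prod_congr rfl this, Finset.prod_mul_distrib]
  ring

end Products

/-! ### Genericity, the Bailey matrix, weight and kernel -/

/-- The nondegeneracy conditions on `q` and `x`. -/
structure Generic {K : Type*} [Field K] {n : ℕ} (q : K) (x : Fin n → K) : Prop where
  q_ne_zero : q ≠ 0
  q_pow_ne_one : ∀ k : ℕ, 1 ≤ k → q ^ k ≠ 1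
  x_ne_zero : ∀ i, x i ≠ 0
  q_pow_mul_ne : ∀ i j, i ≠ j → ∀ k : ℕ, q ^ k * x i ≠ x j
  q_pow_mul_mul_ne_one : ∀ i j, ∀ k : ℕ, q ^ k * x i * x j ≠ 1

/-- The points `b` at which no denominator `(q x_i / b)_{N_i}` vanishes. -/
def Admissible {K : Type*} [Field K] {n : ℕ} (q : K) (x : Fin n → K) (N : Fin n → ℕ) (b : K) :
    Prop :=
  b ≠ 0 ∧ ∀ i, ∀ k < N i, q ^ (k + 1) * x i ≠ b

section Definitions

variable {K : Type*} [Field K] {n : ℕ} (q : K) (x : Fin n → K)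

/-- `∏ i, (b x_i)_{r_i} b^{-r_i}`. -/
def wtNum (b : K) (r : Fin n → ℕ) : K := ∏ i, qp q (b * x i) (r i) / b ^ r i

/-- `∏ i, (q x_i / b)_{r_i}`. -/
def wtDen (b : K) (r : Fin n → ℕ) : K := ∏ i, qp q (q * x i / b) (r i)

/-- `∏ i j, 1 / (q x_i / x_j)_{N_i - r_j}`. -/
def invA (N r : Fin n → ℕ) : K := ∏ i, ∏ j, (qPoch q (q * x i / x j) ((N i : ℤ) - r j))⁻¹

/-- `∏ i j, 1 / (q x_i x_j)_{N_i + r_j}`. -/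
def invC (N r : Fin n → ℕ) : K := ∏ i, ∏ j, (qp q (q * x i * x j) (N i + r j))⁻¹

/-- `∏ i < j, 1 / (q x_i x_j)_{N_i + N_j}`. -/
def invPairs (N : Fin n → ℕ) : K := ∏ i, ∏ j ∈ Finset.Ioi i, (qp q (q * x i * x j) (N i + N j))⁻¹

/-- `∏ i j, (q x_i / x_j)_{s_i - s_j}`. -/
def diagA (s : Fin n → ℕ) : K := ∏ i, ∏ j, qPoch q (q * x i / x j) ((s i : ℤ) - s j)

/-- The weight `∏ i, (b x_i, c x_i)_{r_i} / (q x_i / b, q x_i / c)_{r_i} (q / b c)^{r_i}`. -/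
def baileyWeight (b c : K) (r : Fin n → ℕ) : K :=
  wtNum q x b r * wtNum q x c r / (wtDen q x b r * wtDen q x c r) * q ^ size r

/-- The kernel that carries the `β`-sequence of a `C_n` Bailey pair to that of the next one. -/
def baileyKernel (b c : K) (N s : Fin n → ℕ) : K :=
  invPairs q x N / invPairs q x s * diagA q x s * invA q x N s *
    qPoch q (q / (b * c)) ((size N : ℤ) - size s) * q ^ size s *
    (wtNum q x b s * wtNum q x c s / (wtDen q x b N * wtDen q x c N))

end Definitions

/-! ### Truncation of `N_p` at the points `b = q^{-k}/x_p` -/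

section Generic

variable {K : Type*} [Field K] {n : ℕ} {q : K} {x : Fin n → K}

lemma Generic.ratio_ne_one (h : Generic q x) (i j : Fin n) (k : ℕ) :
    q * x i / x j * q ^ k ≠ 1 := by
  have hj := h.x_ne_zero j
  intro e
  have e' : q ^ (k + 1) * x i = x j := by field_simp at e; rw [pow_succ]; linear_combination e
  rcases eq_or_ne i j with rfl | hij
  · exact h.q_pow_ne_one (k + 1) (by omega) (mul_right_cancel₀ hj (by rw [e', one_mul]))
  · exact h.q_pow_mul_ne i j hij _ e'

lemma Generic.mul_ne_one (h : Generic q x) (i j : Fin n) (k : ℕ) : x i * x j * q ^ k ≠ 1 := by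
  intro e; exact h.q_pow_mul_mul_ne_one i j k (by rw [← e]; ring)

lemma Generic.qp_ratio_ne_zero (h : Generic q x) (i j : Fin n) (k m : ℕ) :
    qp q (q * x i / x j * q ^ k) m ≠ 0 :=
  qp_ne_zero fun l _ => by rw [mul_assoc, ← pow_add]; exact h.ratio_ne_one i j _

lemma Generic.qp_mul_ne_zero (h : Generic q x) (i j : Fin n) (k m : ℕ) :
    qp q (q * x i * x j * q ^ k) m ≠ 0 :=
  qp_ne_zero fun l _ e => h.mul_ne_one i j (k + l + 1) (by rw [← e, pow_succ, pow_add]; ring)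

lemma Generic.qp_ratio_ne_zero' (h : Generic q x) (i j : Fin n) (m : ℕ) :
    qp q (q * x i / x j) m ≠ 0 := by simpa using h.qp_ratio_ne_zero i j 0 m

lemma Generic.qp_mul_ne_zero' (h : Generic q x) (i j : Fin n) (m : ℕ) :
    qp q (q * x i * x j) m ≠ 0 := by simpa using h.qp_mul_ne_zero i j 0 m

lemma Admissible.qp_ne_zero {N : Fin n → ℕ} {b : K} (h : Admissible q x N b) (i : Fin n)
    {m : ℕ} (hm : m ≤ N i) : qp q (q * x i / b) m ≠ 0 :=
  _root_.qp_ne_zero fun k hk e => h.2 i k (hk.trans_le hm) (by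
    have := h.1; field_simp at e; rw [pow_succ]; linear_combination e)

lemma Admissible.wtDen_ne_zero {N r : Fin n → ℕ} {b : K} (h : Admissible q x N b) (hr : r ≤ N) :
    wtDen q x b r ≠ 0 :=
  Finset.prod_ne_zero_iff.2 fun i _ => h.qp_ne_zero i (hr i)

lemma Admissible.mono {N N' : Fin n → ℕ} {b : K} (h : Admissible q x N b) (hN : N' ≤ N) :
    Admissible q x N' b := ⟨h.1, fun i k hk => h.2 i k (hk.trans_le (hN i))⟩

lemma Generic.admissible_inv (h : Generic q x) {p : Fin n} {b : K} {k : ℕ}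
    (hb : b * (x p * q ^ k) = 1) (N : Fin n → ℕ) : Admissible q x N b :=
  ⟨left_ne_zero_of_mul_eq_one hb, fun i l _ e => h.mul_ne_one i p (l + 1 + k) (by
    rw [← hb, ← e, pow_add]; ring)⟩

lemma Generic.invPairs_ne_zero (h : Generic q x) (N : Fin n → ℕ) : invPairs q x N ≠ 0 :=
  Finset.prod_ne_zero_iff.2 fun i _ => Finset.prod_ne_zero_iff.2 fun j _ =>
    inv_ne_zero (h.qp_mul_ne_zero' i j _)

lemma Generic.invA_eq_zero (h : Generic q x) {N r : Fin n → ℕ} (hr : ¬ r ≤ N) :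
    invA q x N r = 0 := by
  obtain ⟨i, hi⟩ : ∃ i, N i < r i := by simpa [Pi.le_def] using hr
  refine Finset.prod_eq_zero (Finset.mem_univ i) (Finset.prod_eq_zero (Finset.mem_univ i) ?_)
  rw [mul_div_assoc, div_self (h.x_ne_zero i), mul_one]
  exact inv_qPoch_self_eq_zero h.q_ne_zero (by omega)

lemma Generic.baileyKernel_eq_zero (h : Generic q x) {N s : Fin n → ℕ} (hs : ¬ s ≤ N) (b c : K) :
    baileyKernel q x b c N s = 0 := by
  simp [baileyKernel, h.invA_eq_zero hs]

/-- Factors of `A_n` type, for the interpolation points `b = q^{-k} / x_p`. -/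
lemma invA_update (h : Generic q x) {N : Fin n → ℕ} {p : Fin n} {k d : ℕ} (hN : N p = k + d)
    {b b' : K} (hb : b * (x p * q ^ k) = 1) (hb' : b' * (x p * q ^ (k + d)) = 1)
    (s : Fin n → ℕ) :
    wtNum q x b s * invA q x N s * ∏ j, qp q (q * x p / x j * q ^ k) d =
      wtNum q x b' s * invA q x (Function.update N p k) s := by
  have hq := h.q_ne_zero
  have key : ∀ j, qp q (b * x j) (s j) / b ^ s j * qp q (q * x p / x j * q ^ k) d *
      (qPoch q (q * x p / x j) ((N p : ℤ) - s j))⁻¹ =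
      qp q (b' * x j) (s j) / b' ^ s j * (qPoch q (q * x p / x j) ((k : ℤ) - s j))⁻¹ := by
    intro j
    have hj := h.x_ne_zero j
    have hp := h.x_ne_zero p
    have e0 : (b⁻¹ : K) = x p * q ^ k := inv_eq_of_mul_eq_one_right hb
    have e0' : (b'⁻¹ : K) = x p * q ^ (k + d) := inv_eq_of_mul_eq_one_right hb'
    have hy : x j / x p ≠ 0 := div_ne_zero hj hp
    have e1 := qp_reverse hq hy k (s j) (b := b * x j) (by
      field_simp; linear_combination hb)
    have e2 := qp_reverse hq hy (k + d) (s j) (b := b' * x j) (by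
      field_simp; linear_combination hb')
    have e3 := inv_qPoch_add hq (h.ratio_ne_one p j) ((k : ℤ) - s j) d
    have e4 : (k : ℤ) - s j + d = (N p : ℤ) - s j := by rw [hN]; push_cast; ring
    rw [e4] at e3
    have ey : q * (x j / x p)⁻¹ = q * x p / x j := by field_simp
    rw [ey] at e1 e2
    set a := q * x p / x j
    -- Both sides split the factorial of length `s_j + d` starting at `a q^{k - s_j}`, once after
    -- `s_j` and once after `d` factors.
    have e5 : qp q (a * q ^ ((k : ℤ) - s j)) (s j) * qp q (a * q ^ k) d =
        qp q (a * q ^ ((k : ℤ) - s j)) d * qp q (a * q ^ (((k + d : ℕ) : ℤ) - s j)) (s j) := by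
      have e6 := qp_add q (a * q ^ ((k : ℤ) - s j)) (s j) d
      rw [add_comm, qp_add] at e6
      have e7 : a * q ^ ((k : ℤ) - s j) * q ^ s j = a * q ^ k := by
        rw [mul_assoc, ← zpow_natCast q (s j), ← zpow_add₀ hq, sub_add_cancel, zpow_natCast]
      have e8 : a * q ^ ((k : ℤ) - s j) * q ^ d = a * q ^ (((k + d : ℕ) : ℤ) - s j) := by
        rw [mul_assoc, ← zpow_natCast q d, ← zpow_add₀ hq]; congr 2; push_cast; ring
      rw [e7, e8] at e6
      exact e6.symm
    rw [e3, div_eq_mul_inv, div_eq_mul_inv, ← inv_pow, ← inv_pow, e0, e0', mul_pow, mul_pow,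
      ← pow_mul, ← pow_mul]
    linear_combination (x p ^ s j * qp q (a * q ^ k) d * (qPoch q a (↑(N p) - ↑(s j)))⁻¹) * e1 -
      (x p ^ s j * (qPoch q a (↑(N p) - ↑(s j)))⁻¹ * qp q (a * q ^ (↑k - (s j : ℤ))) d) * e2 +
      ((-(x j / x p)) ^ s j * q ^ (s j).choose 2 * x p ^ s j *
        (qPoch q a (↑(N p) - ↑(s j)))⁻¹) * e5
  have hprod : (wtNum q x b s * ∏ j, qp q (q * x p / x j * q ^ k) d) *
      (∏ j, (qPoch q (q * x p / x j) ((N p : ℤ) - s j))⁻¹) = wtNum q x b' s *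
      ∏ j, (qPoch q (q * x p / x j) ((k : ℤ) - s j))⁻¹ := by
    simp only [wtNum, ← Finset.prod_mul_distrib]
    exact Finset.prod_congr rfl fun j _ => key j
  have hrest : ∏ i ∈ Finset.univ.erase p,
      ∏ j, (qPoch q (q * x i / x j) ((Function.update N p k i : ℤ) - s j))⁻¹ =
      ∏ i ∈ Finset.univ.erase p, ∏ j, (qPoch q (q * x i / x j) ((N i : ℤ) - s j))⁻¹ :=
    Finset.prod_congr rfl fun i hi => by
      rw [Function.update_of_ne (Finset.ne_of_mem_erase hi)]
  rw [invA, invA, ← Finset.mul_prod_erase _ _ (Finset.mem_univ p),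
    ← Finset.mul_prod_erase Finset.univ (fun i => ∏ j, (qPoch q (q * x i / x j)
      ((Function.update N p k i : ℤ) - s j))⁻¹) (Finset.mem_univ p), hrest,
    Function.update_self]
  linear_combination (∏ i ∈ Finset.univ.erase p,
    ∏ j, (qPoch q (q * x i / x j) ((N i : ℤ) - s j))⁻¹) * hprod

/-- With `y = q x_p x_j`, the arguments `q x_j/b` and `q x_j/b'` are `y q^k` and `y q^{k+d}`. Both
sides are then the reciprocal of `(y)_k (y q^k)_r (y q^{k+d})_r`. -/
lemma qp_inv_mul_qp_inv (h : Generic q x) (p j : Fin n) {k d : ℕ}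
    {b b' : K} (hb : b * (x p * q ^ k) = 1) (hb' : b' * (x p * q ^ (k + d)) = 1) (r : ℕ) :
    (qp q (q * x j / b) r)⁻¹ * (qp q (q * x p * x j) (k + d + r))⁻¹ *
        qp q (q * x p * x j * q ^ k) d =
      (qp q (q * x j / b') r)⁻¹ * (qp q (q * x p * x j) (k + r))⁻¹ := by
  have e0 : q * x j / b = q * x p * x j * q ^ k := by
    rw [div_eq_mul_inv, inv_eq_of_mul_eq_one_right hb]; ring
  have e0' : q * x j / b' = q * x p * x j * q ^ (k + d) := by
    rw [div_eq_mul_inv, inv_eq_of_mul_eq_one_right hb']; ring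
  rw [e0, e0', qp_add q _ (k + d) r, qp_add q _ k d, qp_add q _ k r]
  have h1 := h.qp_mul_ne_zero p j k d
  have h2 := h.qp_mul_ne_zero' p j k
  have h3 := h.qp_mul_ne_zero p j k r
  have h4 := h.qp_mul_ne_zero p j (k + d) r
  field_simp

/-- Factors of `C_n` type, for the interpolation points `b = q^{-k} / x_p`. -/
lemma invC_update (h : Generic q x) {N : Fin n → ℕ} {p : Fin n} {k d : ℕ} (hN : N p = k + d)
    {b b' : K} (hb : b * (x p * q ^ k) = 1) (hb' : b' * (x p * q ^ (k + d)) = 1)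
    (r : Fin n → ℕ) :
    (wtDen q x b r)⁻¹ * invC q x N r * ∏ j, qp q (q * x p * x j * q ^ k) d =
      (wtDen q x b' r)⁻¹ * invC q x (Function.update N p k) r := by
  have hprod : (wtDen q x b r)⁻¹ * (∏ j, (qp q (q * x p * x j) (N p + r j))⁻¹) *
      ∏ j, qp q (q * x p * x j * q ^ k) d =
      (wtDen q x b' r)⁻¹ * ∏ j, (qp q (q * x p * x j) (k + r j))⁻¹ := by
    simp only [wtDen, ← Finset.prod_inv_distrib, ← Finset.prod_mul_distrib, hN]
    exact Finset.prod_congr rfl fun j _ => qp_inv_mul_qp_inv h p j hb hb' (r j)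
  have hrest : ∏ i ∈ Finset.univ.erase p,
      ∏ j, (qp q (q * x i * x j) (Function.update N p k i + r j))⁻¹ =
      ∏ i ∈ Finset.univ.erase p, ∏ j, (qp q (q * x i * x j) (N i + r j))⁻¹ :=
    Finset.prod_congr rfl fun i hi => by
      rw [Function.update_of_ne (Finset.ne_of_mem_erase hi)]
  rw [invC, invC, ← Finset.mul_prod_erase _ _ (Finset.mem_univ p),
    ← Finset.mul_prod_erase Finset.univ (fun i => ∏ j, (qp q (q * x i * x j)
      (Function.update N p k i + r j))⁻¹) (Finset.mem_univ p), hrest,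
    Function.update_self]
  linear_combination (∏ i ∈ Finset.univ.erase p,
    ∏ j, (qp q (q * x i * x j) (N i + r j))⁻¹) * hprod

lemma prod_update_erase (N : Fin n → ℕ) (p : Fin n) (k : ℕ) (f : Fin n → ℕ → K) :
    ∏ i, f i (Function.update N p k i) = f p k * ∏ i ∈ Finset.univ.erase p, f i (N i) := by
  rw [← Finset.mul_prod_erase _ _ (Finset.mem_univ p), Function.update_self]
  congr 1
  exact Finset.prod_congr rfl fun i hi => by
    rw [Function.update_of_ne (Finset.ne_of_mem_erase hi)]

lemma prod_eq_mul_erase (N : Fin n → ℕ) (p : Fin n) (f : Fin n → ℕ → K) :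
    ∏ i, f i (N i) = f p (N p) * ∏ i ∈ Finset.univ.erase p, f i (N i) :=
  (Finset.mul_prod_erase _ (fun i => f i (N i)) (Finset.mem_univ p)).symm

/-- Only pairs containing `p` change. As `invPairs` has no diagonal pair, the factor `j = p` of the
product on the left is absorbed by `(q x_p/b)_{N_p}` instead. -/
lemma invPairs_update (h : Generic q x) {N : Fin n → ℕ} {p : Fin n} {k d : ℕ} (hN : N p = k + d)
    {b b' : K} (hb : b * (x p * q ^ k) = 1) (hb' : b' * (x p * q ^ (k + d)) = 1) :
    (wtDen q x b N)⁻¹ * invPairs q x N * ∏ j, qp q (q * x p * x j * q ^ k) d =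
      (wtDen q x b' (Function.update N p k))⁻¹ * invPairs q x (Function.update N p k) := by
  set N' := Function.update N p k with hN'
  have hratio : invPairs q x N / invPairs q x N' = ∏ j ∈ Finset.univ.erase p,
      (qp q (q * x p * x j) (k + d + N j))⁻¹ / (qp q (q * x p * x j) (k + N j))⁻¹ := by
    simp only [invPairs, ← Finset.prod_div_distrib]
    rw [prod_Ioi_eq_prod_erase p]
    · refine Finset.prod_congr rfl fun j hj => ?_
      rw [hN', Function.update_self, Function.update_of_ne (Finset.ne_of_mem_erase hj), hN]
    · intro i j
      rw [show q * x i * x j = q * x j * x i by ring, add_comm (N i), add_comm (N' i)]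
    · intro i j hi hj
      rw [hN', Function.update_of_ne hi, Function.update_of_ne hj]
      exact div_self (inv_ne_zero (h.qp_mul_ne_zero' i j _))
  rw [div_eq_iff (h.invPairs_ne_zero _)] at hratio
  rw [hratio, wtDen, wtDen, hN', prod_update_erase N p k fun i m => qp q (q * x i / b') m,
    ← Finset.mul_prod_erase _ _ (Finset.mem_univ p), ← hN',
    ← Finset.mul_prod_erase _ (fun j => qp q (q * x p * x j * q ^ k) d) (Finset.mem_univ p)]
  have h1 : (qp q (q * x p / b) (N p))⁻¹ * qp q (q * x p * x p * q ^ k) d =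
      (qp q (q * x p / b') k)⁻¹ := by
    have e0 : q * x p / b = q * x p * x p * q ^ k := by
      rw [div_eq_mul_inv, inv_eq_of_mul_eq_one_right hb]; ring
    have e0' : q * x p / b' = q * x p * x p * q ^ k * q ^ d := by
      rw [div_eq_mul_inv, inv_eq_of_mul_eq_one_right hb', pow_add]; ring
    rw [e0, e0', hN, add_comm, qp_add]
    have h1 := h.qp_mul_ne_zero p p k d
    rw [mul_inv, mul_right_comm, inv_mul_cancel₀ h1, one_mul]
  have h2 : (∏ j ∈ Finset.univ.erase p, qp q (q * x j / b) (N j))⁻¹ *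
      (∏ j ∈ Finset.univ.erase p, (qp q (q * x p * x j) (k + d + N j))⁻¹ /
        (qp q (q * x p * x j) (k + N j))⁻¹) *
      ∏ j ∈ Finset.univ.erase p, qp q (q * x p * x j * q ^ k) d =
      (∏ j ∈ Finset.univ.erase p, qp q (q * x j / b') (N j))⁻¹ := by
    simp only [← Finset.prod_inv_distrib, ← Finset.prod_mul_distrib]
    refine Finset.prod_congr rfl fun j _ => ?_
    have e := qp_inv_mul_qp_inv h p j hb hb' (N j)
    have h3 := h.qp_mul_ne_zero' p j (k + N j)
    rw [div_inv_eq_mul]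
    calc _ = _ * qp q (q * x p * x j) (k + N j) := by
          rw [← mul_assoc, mul_right_comm]
      _ = _ := by rw [e, inv_mul_cancel_right₀ h3]
  rw [mul_inv, mul_inv, ← h1, ← h2]
  ring

/-- At this `b`, `q/(bc) = (q x_p/c) q^k` starts where `(q x_p/c)_k` ends, so the block of length
`d` cancels against the end of `(q x_p/c)_{k+d}`. The bound on `s` keeps the index of the remaining
factorial nonnegative. -/
lemma wtDen_inv_mul_qPoch {N s : Fin n → ℕ} {p : Fin n} {k d : ℕ} (hN : N p = k + d)
    {b b' c : K} (hb : b * (x p * q ^ k) = 1) (hb' : b' * (x p * q ^ (k + d)) = 1)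
    (hc : Admissible q x N c) (hs : s ≤ Function.update N p k) :
    (wtDen q x c N)⁻¹ * qPoch q (q / (b * c)) ((size N : ℤ) - size s) =
      (wtDen q x c (Function.update N p k))⁻¹ *
        qPoch q (q / (b' * c)) ((size (Function.update N p k) : ℤ) - size s) := by
  set N' := Function.update N p k with hN'
  have hsz : size N = size N' + d := by
    have e1 : size N = N p + ∑ i ∈ Finset.univ.erase p, N i :=
      (Finset.add_sum_erase _ _ (Finset.mem_univ p)).symm
    have e2 : size N' = N' p + ∑ i ∈ Finset.univ.erase p, N' i :=
      (Finset.add_sum_erase _ _ (Finset.mem_univ p)).symm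
    have e3 : ∑ i ∈ Finset.univ.erase p, N' i = ∑ i ∈ Finset.univ.erase p, N i :=
      Finset.sum_congr rfl fun i hi => by
        rw [hN', Function.update_of_ne (Finset.ne_of_mem_erase hi)]
    have e4 : N' p = k := Function.update_self ..
    omega
  obtain ⟨m, hm⟩ : ∃ m, size N' = size s + m :=
    Nat.exists_eq_add_of_le (Finset.sum_le_sum fun i _ => hs i)
  have e1 : (size N : ℤ) - size s = ((d + m : ℕ) : ℤ) := by
    rw [hsz, hm]; push_cast; ring
  have e2 : (size N' : ℤ) - size s = (m : ℤ) := by rw [hm]; push_cast; ring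
  have e0 : q / (b * c) = q * x p / c * q ^ k := by
    rw [div_eq_mul_inv, mul_inv, inv_eq_of_mul_eq_one_right hb]; ring
  have e0' : q / (b' * c) = q * x p / c * q ^ k * q ^ d := by
    rw [div_eq_mul_inv, mul_inv, inv_eq_of_mul_eq_one_right hb', pow_add]; ring
  have h1 := hc.qp_ne_zero p le_rfl
  rw [e1, e2, e0, e0', qPoch_natCast, qPoch_natCast, qp_add, wtDen, wtDen, hN',
    prod_update_erase N p k fun i m => qp q (q * x i / c) m,
    prod_eq_mul_erase N p fun i m => qp q (q * x i / c) m, hN, qp_add]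
  rw [hN, qp_add] at h1
  have h2 := left_ne_zero_of_mul h1
  have h3 := right_ne_zero_of_mul h1
  rw [mul_inv, mul_inv, mul_inv]
  generalize qp q (q * x p / c * q ^ k) d = u at h3 ⊢
  field_simp

/-- The factor by which both sides of the interpolated identities change when `b = q^{-k} / x_p`,
`N_p = k + d` is replaced by `b' = q^{-k-d} / x_p`, `N_p = k`. -/
def stepFactor (q : K) (x : Fin n → K) (p : Fin n) (k d : ℕ) : K :=
  (∏ j, qp q (q * x p / x j * q ^ k) d) * ∏ j, qp q (q * x p * x j * q ^ k) d

lemma Generic.stepFactor_ne_zero (h : Generic q x) (p : Fin n) (k d : ℕ) :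
    stepFactor q x p k d ≠ 0 :=
  mul_ne_zero (Finset.prod_ne_zero_iff.2 fun j _ => h.qp_ratio_ne_zero p j k d)
    (Finset.prod_ne_zero_iff.2 fun j _ => h.qp_mul_ne_zero p j k d)

/-- The scaling factor is independent of `s`, and it is the same for the kernel here and for the
weighted matrix in `baileyWeight_update`. This is what reduces an interpolated identity to the
truncated one. -/
lemma baileyKernel_update (h : Generic q x) {N s : Fin n → ℕ} {p : Fin n} {k d : ℕ}
    (hN : N p = k + d) {b b' c : K} (hb : b * (x p * q ^ k) = 1)
    (hb' : b' * (x p * q ^ (k + d)) = 1) (hc : Admissible q x N c)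
    (hs : s ≤ Function.update N p k) :
    baileyKernel q x b c N s * stepFactor q x p k d =
      baileyKernel q x b' c (Function.update N p k) s := by
  have e1 := invA_update h hN hb hb' s
  have e2 := invPairs_update h hN hb hb'
  have e3 := wtDen_inv_mul_qPoch hN hb hb' hc hs
  simp only [baileyKernel, stepFactor, div_eq_mul_inv, mul_inv] at *
  calc _ = (wtNum q x b s * invA q x N s * ∏ j, qp q (q * x p * (x j)⁻¹ * q ^ k) d) *
      ((wtDen q x b N)⁻¹ * invPairs q x N * ∏ j, qp q (q * x p * x j * q ^ k) d) *
      ((wtDen q x c N)⁻¹ * qPoch q (q * (b⁻¹ * c⁻¹)) (↑(size N) - ↑(size s))) *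
      ((invPairs q x s)⁻¹ * diagA q x s * q ^ size s * wtNum q x c s) := by ring
    _ = _ := by rw [e1, e2, e3]; ring

lemma baileyWeight_update (h : Generic q x) {N : Fin n → ℕ} {p : Fin n} {k d : ℕ}
    (hN : N p = k + d) {b b' : K} (hb : b * (x p * q ^ k) = 1)
    (hb' : b' * (x p * q ^ (k + d)) = 1) (c : K) (r : Fin n → ℕ) :
    baileyWeight q x b c r * (invA q x N r * invC q x N r) * stepFactor q x p k d =
      baileyWeight q x b' c r *
        (invA q x (Function.update N p k) r * invC q x (Function.update N p k) r) := by
  have e1 := invA_update h hN hb hb' r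
  have e2 := invC_update h hN hb hb' r
  simp only [baileyWeight, stepFactor, div_eq_mul_inv, mul_inv] at *
  calc _ = (wtNum q x b r * invA q x N r * ∏ j, qp q (q * x p * (x j)⁻¹ * q ^ k) d) *
      ((wtDen q x b r)⁻¹ * invC q x N r * ∏ j, qp q (q * x p * x j * q ^ k) d) *
      ((wtDen q x c r)⁻¹ * q ^ size r * wtNum q x c r) := by ring
    _ = _ := by rw [e1, e2]; ring

end Generic

/-! ### Polynomial functions and their determination by values -/

/-- `f` is a polynomial function of degree at most `d`. -/
def IsPolyFun {K : Type*} [Field K] (d : ℕ) (f : K → K) : Prop :=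
  ∃ p : Polynomial K, p.natDegree ≤ d ∧ ∀ b, p.eval b = f b

namespace IsPolyFun

variable {K : Type*} [Field K] {d e : ℕ} {f g : K → K}

lemma const (a : K) : IsPolyFun 0 fun _ : K => a := ⟨Polynomial.C a, by simp, by simp⟩

lemma linear (u v : K) : IsPolyFun 1 fun b => u + v * b :=
  ⟨Polynomial.C v * Polynomial.X + Polynomial.C u, Polynomial.natDegree_linear_le,
    fun b => by simp [add_comm]⟩

lemma mono (h : IsPolyFun d f) (hde : d ≤ e) : IsPolyFun e f :=
  let ⟨p, hp, h⟩ := h; ⟨p, hp.trans hde, h⟩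

lemma mul (hf : IsPolyFun d f) (hg : IsPolyFun e g) : IsPolyFun (d + e) fun b => f b * g b :=
  let ⟨p, hp, hpf⟩ := hf
  let ⟨r, hr, hrg⟩ := hg
  ⟨p * r, Polynomial.natDegree_mul_le_of_le hp hr, fun b => by
    rw [Polynomial.eval_mul, hpf, hrg]⟩

lemma const_mul (hf : IsPolyFun d f) (a : K) : IsPolyFun d fun b => a * f b := by
  simpa using (const a).mul hf

lemma sum {ι : Type*} {s : Finset ι} {f : ι → K → K} (h : ∀ i ∈ s, IsPolyFun d (f i)) :
    IsPolyFun d fun b => ∑ i ∈ s, f i b := by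
  choose! p hp hpf using h
  exact ⟨∑ i ∈ s, p i, Polynomial.natDegree_sum_le_of_forall_le _ _ hp, fun b => by
    rw [Polynomial.eval_finsetSum]; exact Finset.sum_congr rfl fun i hi => hpf i hi b⟩

lemma prod {ι : Type*} {s : Finset ι} {d : ι → ℕ} {f : ι → K → K}
    (h : ∀ i ∈ s, IsPolyFun (d i) (f i)) :
    IsPolyFun (∑ i ∈ s, d i) fun b => ∏ i ∈ s, f i b := by
  choose! p hp hpf using h
  exact ⟨∏ i ∈ s, p i, (Polynomial.natDegree_prod_le _ _).trans (Finset.sum_le_sum hp), fun b => by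
    rw [Polynomial.eval_prod]; exact Finset.prod_congr rfl fun i hi => hpf i hi b⟩

lemma eq_of_card {S : Finset K} (hf : IsPolyFun d f) (hg : IsPolyFun d g) (hS : d < S.card)
    (h : ∀ b ∈ S, f b = g b) (b : K) : f b = g b := by
  obtain ⟨p, hp, hpf⟩ := hf
  obtain ⟨r, hr, hrg⟩ := hg
  have : p = r := by
    refine Polynomial.eq_of_natDegree_lt_card_of_eval_eq' p r S (fun b hb => ?_)
      (max_lt (hp.trans_lt hS) (hr.trans_lt hS))
    rw [hpf, hrg, h b hb]
  rw [← hpf, ← hrg, this]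

end IsPolyFun

/-! ### Clearing denominators in `b`, and the interpolation principle -/

section Clearing

variable {K : Type*} [Field K]

/-- The homogeneous `q`-shifted factorial `b^n (y / b)_n`. -/
def qpHom (q y : K) (n : ℕ) (b : K) : K := ∏ k ∈ Finset.range n, (b - y * q ^ k)

lemma isPolyFun_qpHom (q y : K) (n : ℕ) : IsPolyFun n (qpHom q y n) := by
  have := IsPolyFun.prod (s := Finset.range n) (d := fun _ => 1)
    (f := fun k b => -(y * q ^ k) + 1 * b) fun k _ => IsPolyFun.linear _ _
  simp only [Finset.sum_const, Finset.card_range, smul_eq_mul, mul_one] at this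
  convert this using 1
  ext b
  exact Finset.prod_congr rfl fun k _ => by ring

lemma isPolyFun_qp (q u : K) (n : ℕ) : IsPolyFun n fun b => qp q (b * u) n := by
  have := IsPolyFun.prod (s := Finset.range n) (d := fun _ => 1)
    (f := fun k b => 1 + -(u * q ^ k) * b) fun k _ => IsPolyFun.linear _ _
  simp only [Finset.sum_const, Finset.card_range, smul_eq_mul, mul_one] at this
  convert this using 1
  ext b
  exact Finset.prod_congr rfl fun k _ => by ring

lemma qpHom_eq {b : K} (hb : b ≠ 0) (q y : K) (n : ℕ) : qpHom q y n b = b ^ n * qp q (y / b) n := by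
  have := Finset.prod_const (s := Finset.range n) b
  rw [Finset.card_range] at this
  rw [qpHom, qp, ← this, ← Finset.prod_mul_distrib]
  exact Finset.prod_congr rfl fun k _ => by field_simp

variable {n : ℕ} (q : K) (x : Fin n → K)

/-- `∏ i, (b x_i)_{r_i}`. -/
def numProd (r : Fin n → ℕ) (b : K) : K := ∏ i, qp q (b * x i) (r i)

/-- `∏ i, b^{N_i - r_i} (q^{r_i + 1} x_i / b)_{N_i - r_i}`. -/
def remProd (N r : Fin n → ℕ) (b : K) : K := ∏ i, qpHom q (q * x i * q ^ r i) (N i - r i) b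

/-- The part of `baileyKernel` that does not depend on `b`. -/
def kernelCoeff (c : K) (N s : Fin n → ℕ) : K :=
  invPairs q x N / invPairs q x s * diagA q x s * invA q x N s * q ^ size s *
    (wtNum q x c s / wtDen q x c N)

/-- The part of `baileyWeight` that does not depend on `b`. -/
def weightCoeff (c : K) (r : Fin n → ℕ) : K := wtNum q x c r / wtDen q x c r * q ^ size r

variable {q x}

lemma isPolyFun_numProd (r : Fin n → ℕ) : IsPolyFun (size r) (numProd q x r) :=
  IsPolyFun.prod fun i _ => isPolyFun_qp q (x i) (r i)

lemma isPolyFun_remProd (N r : Fin n → ℕ) :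
    IsPolyFun (∑ i, (N i - r i)) (remProd q x N r) :=
  IsPolyFun.prod fun _ _ => isPolyFun_qpHom q _ _

lemma sum_sub_add_size {N r : Fin n → ℕ} (hr : r ≤ N) : size r + ∑ i, (N i - r i) = size N := by
  rw [size, size, ← Finset.sum_add_distrib]
  exact Finset.sum_congr rfl fun i _ => Nat.add_sub_cancel' (hr i)

lemma size_mono {N r : Fin n → ℕ} (hr : r ≤ N) : size r ≤ size N :=
  Finset.sum_le_sum fun i _ => hr i

lemma wtDen_mul_pow {N : Fin n → ℕ} {b : K} (hb : b ≠ 0) :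
    wtDen q x b N * b ^ size N = remProd q x N 0 b := by
  rw [wtDen, remProd, size, ← Finset.prod_pow_eq_pow_sum, ← Finset.prod_mul_distrib]
  refine Finset.prod_congr rfl fun i _ => ?_
  rw [qpHom_eq hb]
  simp [mul_comm]

lemma wtNum_mul_pow {s : Fin n → ℕ} {b : K} (hb : b ≠ 0) :
    wtNum q x b s * b ^ size s = numProd q x s b := by
  rw [wtNum, numProd, size, ← Finset.prod_pow_eq_pow_sum, ← Finset.prod_mul_distrib]
  exact Finset.prod_congr rfl fun i _ => div_mul_cancel₀ _ (pow_ne_zero _ hb)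

lemma wtDen_mul_remProd {N r : Fin n → ℕ} (hr : r ≤ N) {b : K} (hb : b ≠ 0) :
    wtDen q x b r * b ^ size r * remProd q x N r b = remProd q x N 0 b := by
  rw [wtDen_mul_pow hb, remProd, remProd, remProd, ← Finset.prod_mul_distrib]
  refine Finset.prod_congr rfl fun i _ => ?_
  obtain ⟨m, hm⟩ := Nat.exists_eq_add_of_le (hr i)
  simp only [Pi.zero_apply, pow_zero, mul_one, tsub_zero]
  rw [hm, Nat.add_sub_cancel_left]
  simp only [qpHom, Finset.prod_range_add, pow_add, mul_assoc]

lemma Admissible.remProd_ne_zero {N : Fin n → ℕ} {b : K} (h : Admissible q x N b) :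
    remProd q x N 0 b ≠ 0 := by
  rw [← wtDen_mul_pow h.1]
  exact mul_ne_zero (h.wtDen_ne_zero le_rfl) (pow_ne_zero _ h.1)

/-- The power `b^{|N|}` splits as `b^{|s|} b^{|N|-|s|}`: the first part clears `wtNum`, the second
homogenises `(q/bc)_{|N|-|s|}`. The degree is therefore `|N|` for every `s`. -/
lemma baileyKernel_mul_remProd {N s : Fin n → ℕ} (hs : s ≤ N) {b : K} (hb : Admissible q x N b)
    (c : K) : baileyKernel q x b c N s * remProd q x N 0 b =
      kernelCoeff q x c N s * (numProd q x s b * qpHom q (q / c) (size N - size s) b) := by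
  have hb0 := hb.1
  have hden := hb.wtDen_ne_zero le_rfl
  obtain ⟨m, hm⟩ := Nat.exists_eq_add_of_le (size_mono hs)
  have e : (size N : ℤ) - size s = (m : ℤ) := by rw [hm]; push_cast; ring
  rw [← wtDen_mul_pow hb0, ← wtNum_mul_pow hb0, qpHom_eq hb0, baileyKernel, kernelCoeff, e,
    qPoch_natCast, hm, Nat.add_sub_cancel_left, pow_add, div_div, mul_comm c b]
  field_simp

lemma baileyWeight_mul_remProd {N r : Fin n → ℕ} (hr : r ≤ N) {b : K} (hb : Admissible q x N b)
    (c : K) : baileyWeight q x b c r * remProd q x N 0 b =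
      weightCoeff q x c r * (numProd q x r b * remProd q x N r b) := by
  have hb0 := hb.1
  have hden := hb.wtDen_ne_zero hr
  rw [← wtDen_mul_remProd hr hb0, ← wtNum_mul_pow hb0, baileyWeight, weightCoeff]
  field_simp

lemma isPolyFun_kernel {N s : Fin n → ℕ} (hs : s ≤ N) (c : K) : IsPolyFun (size N)
    fun b => numProd q x s b * qpHom q (q / c) (size N - size s) b :=
  ((isPolyFun_numProd s).mul (isPolyFun_qpHom q _ _)).mono (by have := size_mono hs; omega)

lemma isPolyFun_weight {N r : Fin n → ℕ} (hr : r ≤ N) : IsPolyFun (size N)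
    fun b => numProd q x r b * remProd q x N r b :=
  ((isPolyFun_numProd r).mul (isPolyFun_remProd N r)).mono (sum_sub_add_size hr).le

/-- Interpolation at the points `q^{-k} / x_p`, `k < N_p`, and one more point. -/
lemma eq_of_interpolation (h : Generic q x) {N : Fin n → ℕ} {f g : K → K}
    (hf : IsPolyFun (size N) f) (hg : IsPolyFun (size N) g)
    (hfg : ∀ p, ∀ k < N p, ∀ b, b * (x p * q ^ k) = 1 → f b = g b)
    {e : K} (he : ∀ p, ∀ k < N p, e * (x p * q ^ k) ≠ 1) (hfe : f e = g e) (b : K) :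
    f b = g b := by
  classical
  have hne : ∀ i k, x i * q ^ k ≠ 0 := fun i k =>
    mul_ne_zero (h.x_ne_zero i) (pow_ne_zero _ h.q_ne_zero)
  -- The interpolation points are distinct: a coincidence means `q^{l-k} x_j = x_i`, which
  -- genericity allows only for `i = j` and `k = l`.
  have hlt : ∀ i j k l, k ≤ l → x i * q ^ k = x j * q ^ l → i = j ∧ k = l := by
    intro i j k l hkl e
    obtain ⟨m, rfl⟩ := Nat.exists_eq_add_of_le hkl
    have e' : q ^ m * x j = x i := by
      refine mul_right_cancel₀ (pow_ne_zero k h.q_ne_zero) ?_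
      rw [e, pow_add]; ring
    have hij : j = i := by
      by_contra hij
      exact h.q_pow_mul_ne j i hij m e'
    subst hij
    refine ⟨rfl, ?_⟩
    by_contra hm
    exact h.q_pow_ne_one m (by omega) (mul_right_cancel₀ (h.x_ne_zero j) (by rw [e', one_mul]))
  let S : Finset K := (Finset.univ.sigma fun i => Finset.range (N i)).image
    fun y : (_ : Fin n) × ℕ => (x y.1 * q ^ y.2)⁻¹
  have hcard : S.card = size N := by
    rw [Finset.card_image_of_injective, Finset.card_sigma]
    · simp [size]
    · rintro ⟨i, k⟩ ⟨j, l⟩ e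
      have e := inv_injective e
      rcases le_total k l with hkl | hkl
      · obtain ⟨rfl, rfl⟩ := hlt i j k l hkl e; rfl
      · obtain ⟨rfl, rfl⟩ := hlt j i l k hkl e.symm; rfl
  have heS : e ∉ S := by
    simp only [S, Finset.mem_image, Finset.mem_sigma, Finset.mem_univ, true_and,
      Finset.mem_range, not_exists, not_and]
    rintro ⟨i, k⟩ hk rfl
    exact he i k hk (inv_mul_cancel₀ (hne i k))
  refine IsPolyFun.eq_of_card (S := insert e S) hf hg (by
    rw [Finset.card_insert_of_notMem heS, hcard]; exact Nat.lt_succ_self _) ?_ b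
  intro b hb
  rcases Finset.mem_insert.1 hb with rfl | hb
  · exact hfe
  · simp only [S, Finset.mem_image, Finset.mem_sigma, Finset.mem_univ, true_and,
      Finset.mem_range] at hb
    obtain ⟨⟨i, k⟩, hk, rfl⟩ := hb
    exact hfg i k hk _ (inv_mul_cancel₀ (hne i k))

end Clearing

/-! ### The Bailey lemma -/

section BaileyLemma

variable {K : Type*} [Field K] {n : ℕ} {q : K} {x : Fin n → K}

/-- The second condition excludes the poles at negative index, where the division convention assigns
the value `0`. -/
lemma qPoch_ne_zero (hq : q ≠ 0) {a : K} (h : ∀ k : ℕ, a * q ^ k ≠ 1)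
    (h' : ∀ k : ℕ, a ≠ q ^ (k + 1)) (k : ℤ) : qPoch q a k ≠ 0 := by
  rcases k with k | k
  · exact qp_ne_zero fun l _ => h l
  · refine fun e0 => absurd (inv_eq_zero.2 e0) ?_
    rw [qPoch_negSucc]
    refine Finset.prod_ne_zero_iff.2 fun l _ => sub_ne_zero.2 fun e => h' l ?_
    rw [zpow_neg, ← div_eq_mul_inv, eq_div_iff (zpow_ne_zero _ hq)] at e
    rw [one_mul] at e
    exact_mod_cast e.symm

lemma diagA_mul_invA_self (h : Generic q x) (N : Fin n → ℕ) : diagA q x N * invA q x N N = 1 := by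
  simp only [diagA, invA, ← Finset.prod_mul_distrib]
  refine Finset.prod_eq_one fun i _ => Finset.prod_eq_one fun j _ => mul_inv_cancel₀ ?_
  -- The diagonal is treated apart: its argument `q` is excluded in `qPoch_ne_zero`, but the index
  -- is `0`.
  rcases eq_or_ne i j with rfl | hij
  · rw [sub_self]; simp [qPoch]
  · refine qPoch_ne_zero h.q_ne_zero (h.ratio_ne_one i j) (fun k e => ?_) _
    have hj := h.x_ne_zero j
    refine h.q_pow_mul_ne j i hij.symm k (mul_left_cancel₀ h.q_ne_zero ?_)
    rw [div_eq_iff hj] at e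
    rw [e, pow_succ]; ring

lemma size_lt_size {N s : Fin n → ℕ} (hs : s ≤ N) (hne : s ≠ N) : size s < size N := by
  obtain ⟨i, hi⟩ : ∃ i, s i ≠ N i := by
    by_contra! hall
    exact hne (funext hall)
  exact Finset.sum_lt_sum (fun i _ => hs i) ⟨i, Finset.mem_univ i, lt_of_le_of_ne (hs i) hi⟩

lemma update_le {N : Fin n → ℕ} {p : Fin n} {k : ℕ} (hk : k ≤ N p) :
    Function.update N p k ≤ N := update_le_iff.2 ⟨hk, fun _ _ => le_rfl⟩

lemma size_update_lt {N : Fin n → ℕ} {p : Fin n} {k : ℕ} (hk : k < N p) :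
    size (Function.update N p k) < size N :=
  size_lt_size (update_le hk.le) fun e => by
    have := congrFun e p; rw [Function.update_self] at this; omega

/-- This cuts the sums off: `(b x_p)_{s_p}` contains `1 - b x_p q^k = 0` as soon as `s_p > k`. -/
lemma wtNum_eq_zero {N s : Fin n → ℕ} {p : Fin n} {k : ℕ} {b : K} (hb : b * (x p * q ^ k) = 1)
    (hs : s ≤ N) (hs' : ¬ s ≤ Function.update N p k) : wtNum q x b s = 0 := by
  have : k < s p := by
    by_contra! hk
    exact hs' (le_update_iff.2 ⟨hk, fun i _ => hs i⟩)
  refine Finset.prod_eq_zero (Finset.mem_univ p) ?_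
  rw [qp_eq_zero this (by rw [mul_assoc, hb]), zero_div]

lemma sum_Icc_update {N : Fin n → ℕ} {p : Fin n} {k : ℕ} (hk : k ≤ N p) {F : (Fin n → ℕ) → K}
    (hF : ∀ s, s ≤ N → ¬ s ≤ Function.update N p k → F s = 0) :
    ∑ s ∈ Finset.Icc 0 N, F s = ∑ s ∈ Finset.Icc 0 (Function.update N p k), F s := by
  refine (Finset.sum_subset (Finset.Icc_subset_Icc le_rfl (update_le hk)) fun s hs hs' => ?_).symm
  exact hF s (Finset.mem_Icc.1 hs).2 fun hle => hs' (Finset.mem_Icc.2 ⟨zero_le, hle⟩)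

/-- At `b = q/c` one has `b x_i = q x_i/c` and `q x_i/b = c x_i`. So `numProd` cancels `wtDen`, and
`remProd` completes `(c x_i)_{r_i}` to `(c x_i)_{N_i}`; the dependence on `r` disappears. -/
lemma numProd_mul_remProd (h : Generic q x) {N r : Fin n → ℕ} (hr : r ≤ N) {c : K}
    (hc : Admissible q x N c) :
    weightCoeff q x c r * (numProd q x r (q / c) * remProd q x N r (q / c)) =
      weightCoeff q x c N * numProd q x N (q / c) := by
  have e : ∀ s, numProd q x s (q / c) = wtDen q x c s := fun s =>
    Finset.prod_congr rfl fun i _ => by congr 1; ring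
  have hq := h.q_ne_zero
  have hc0 := hc.1
  have e2 : wtNum q x c r * q ^ size r * remProd q x N r (q / c) = wtNum q x c N * q ^ size N := by
    simp only [wtNum, remProd, size, ← Finset.prod_pow_eq_pow_sum, ← Finset.prod_mul_distrib]
    refine Finset.prod_congr rfl fun i _ => ?_
    obtain ⟨m, hm⟩ := Nat.exists_eq_add_of_le (hr i)
    rw [hm, Nat.add_sub_cancel_left, qpHom_eq (div_ne_zero hq hc0), qp_add]
    have : q * x i * q ^ r i / (q / c) = c * x i * q ^ r i := by field_simp
    rw [this, div_pow, pow_add, pow_add]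
    field_simp
  rw [weightCoeff, weightCoeff, e, e]
  have h1 := hc.wtDen_ne_zero hr
  have h2 := hc.wtDen_ne_zero le_rfl
  field_simp
  linear_combination e2

/-- The `C_n` Bailey lemma of Milne and Lilly, in matrix form. -/
theorem sum_baileyKernel (h : Generic q x) (r : Fin n → ℕ) {c : K} (N : Fin n → ℕ) {b : K}
    (hb : Admissible q x N b) (hc : Admissible q x N c) :
    ∑ s ∈ Finset.Icc 0 N, baileyKernel q x b c N s * (invA q x s r * invC q x s r) =
      baileyWeight q x b c r * (invA q x N r * invC q x N r) := by
  -- Truncation changes `b` together with `N`; `c`, `r` and `x` stay fixed.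
  induction hm : size N using Nat.strong_induction_on generalizing N b with
  | _ m ih =>
  subst hm
  -- Otherwise both sides vanish. The bound is needed for `remProd`, which uses the natural number
  -- differences `N_i - r_i`.
  by_cases hr : r ≤ N
  swap
  · rw [h.invA_eq_zero hr]
    refine (Finset.sum_eq_zero fun s hs => ?_).trans (by simp)
    rw [h.invA_eq_zero fun hrs => hr (hrs.trans (Finset.mem_Icc.1 hs).2)]
    simp
  have hclear : ∀ b, Admissible q x N b →
      ((∑ s ∈ Finset.Icc 0 N, baileyKernel q x b c N s * (invA q x s r * invC q x s r)) *
        remProd q x N 0 b = ∑ s ∈ Finset.Icc 0 N, (kernelCoeff q x c N s *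
          (invA q x s r * invC q x s r)) *
            (numProd q x s b * qpHom q (q / c) (size N - size s) b)) ∧
      baileyWeight q x b c r * (invA q x N r * invC q x N r) * remProd q x N 0 b =
        (weightCoeff q x c r * (invA q x N r * invC q x N r)) *
          (numProd q x r b * remProd q x N r b) := by
    intro b hb
    constructor
    · rw [Finset.sum_mul]
      refine Finset.sum_congr rfl fun s hs => ?_
      linear_combination (invA q x s r * invC q x s r) *
        baileyKernel_mul_remProd (Finset.mem_Icc.1 hs).2 hb c
    · linear_combination (invA q x N r * invC q x N r) * baileyWeight_mul_remProd hr hb c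
  refine mul_right_cancel₀ hb.remProd_ne_zero ?_
  rw [(hclear b hb).1, (hclear b hb).2]
  -- The point `q/c` may fail to be admissible, so only the cleared forms are compared there.
  refine eq_of_interpolation (e := q / c) h
    (f := fun b => ∑ s ∈ Finset.Icc 0 N, (kernelCoeff q x c N s *
          (invA q x s r * invC q x s r)) *
            (numProd q x s b * qpHom q (q / c) (size N - size s) b))
    (g := fun b => (weightCoeff q x c r * (invA q x N r * invC q x N r)) *
          (numProd q x r b * remProd q x N r b))
    (IsPolyFun.sum fun s hs => (isPolyFun_kernel (Finset.mem_Icc.1 hs).2 c).const_mul _)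
    ((isPolyFun_weight hr).const_mul _) ?_ ?_ ?_ b
  · intro p k hk b hb
    have hbN := h.admissible_inv hb N
    obtain ⟨d, hd⟩ := Nat.exists_eq_add_of_le hk.le
    have hb' : (x p * q ^ (k + d))⁻¹ * (x p * q ^ (k + d)) = 1 := inv_mul_cancel₀
      (mul_ne_zero (h.x_ne_zero p) (pow_ne_zero _ h.q_ne_zero))
    have hle := update_le hk.le
    have key := ih _ (size_update_lt hk) (Function.update N p k) (h.admissible_inv hb' _)
      (hc.mono hle) rfl
    rw [← (hclear b hbN).1, ← (hclear b hbN).2]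
    congr 1
    refine mul_right_cancel₀ (h.stepFactor_ne_zero p k d) ?_
    rw [baileyWeight_update h hd hb hb', ← key, sum_Icc_update hk.le, Finset.sum_mul]
    · refine Finset.sum_congr rfl fun s hs => ?_
      rw [← baileyKernel_update h hd hb hb' hc (Finset.mem_Icc.1 hs).2]
      ring
    · intro s hs hs'
      simp [baileyKernel, wtNum_eq_zero hb hs hs']
  · intro p k hk e
    refine hc.2 p k hk ?_
    have := hc.1
    field_simp at e
    rw [pow_succ, ← e]; ring
  -- At `b = q/c` every term with `s ≠ N` contains the vanishing first factor of `qpHom`.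
  · have hNN := diagA_mul_invA_self h N
    rw [Finset.sum_eq_single_of_mem N (Finset.mem_Icc.2 ⟨zero_le, le_rfl⟩)]
    · have e1 : kernelCoeff q x c N N = weightCoeff q x c N := by
        rw [kernelCoeff, div_self (h.invPairs_ne_zero N), one_mul, hNN, weightCoeff]; ring
      rw [e1, Nat.sub_self]
      simp only [qpHom, Finset.range_zero, Finset.prod_empty, mul_one]
      linear_combination -(invA q x N r * invC q x N r) * numProd_mul_remProd h hr hc
    · intro s hs hsN
      have hlt := size_lt_size (Finset.mem_Icc.1 hs).2 hsN
      have : qpHom q (q / c) (size N - size s) (q / c) = 0 :=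
        Finset.prod_eq_zero (Finset.mem_range.2 (by omega : 0 < size N - size s)) (by simp)
      simp [this]

end BaileyLemma

/-! ### The shift `x_p ↦ q x_p` on the factors of a single term -/

section Shift

variable {K : Type*} [Field K] {n : ℕ}

/-- The factor of `alphaSeq` and of the Bailey matrix that belongs to the ordered pair `(u, v)` of
variables with `N`-value `m` and summation indices `a` and `t`. -/
def pairFactor (q u v : K) (m a t : ℕ) : K :=
  qp q (u * v) a / qp q (q * u / v) a * ((-(u / v)) ^ a * q ^ a.choose 2) *
    ((qPoch q (q * u / v) ((m : ℤ) - t))⁻¹ * (qp q (q * u * v) (m + t))⁻¹)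

/-- The factor of `numProd * remProd` that belongs to the variable `u`. -/
def pointFactor (q u : K) (m a : ℕ) (b : K) : K :=
  qp q (b * u) a * qpHom q (q * u * q ^ a) (m - a) b

lemma neg_pow_succ_mul_choose (q y : K) (a : ℕ) :
    (-y) ^ (a + 1) * q ^ (a + 1).choose 2 = -y * ((-(q * y)) ^ a * q ^ a.choose 2) := by
  rw [Nat.choose_succ_succ' a 1, Nat.choose_one_right, pow_add q, neg_pow y, neg_pow (q * y),
    mul_pow, pow_succ, pow_succ]
  ring

/-- This covers the ordered pairs `(p, j)`: each factorial loses its first factor, so the multiplier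
involves neither `a` nor `t`. -/
lemma pairFactor_shift_left {q u v : K} (hq : q ≠ 0) (h1 : q * u / v ≠ 1)
    (h2 : q * u * v ≠ 1) (m a t : ℕ) :
    pairFactor q u v (m + 1) (a + 1) t =
      (1 - u * v) * (-(u / v)) / ((1 - q * u / v) ^ 2 * (1 - q * u * v)) *
        pairFactor q (q * u) v m a t := by
  have h1' : 1 - q * u / v ≠ 0 := sub_ne_zero.2 h1.symm
  have h2' : 1 - q * u * v ≠ 0 := sub_ne_zero.2 h2.symm
  have e1 : ((m + 1 : ℕ) : ℤ) - t = (m : ℤ) - t + 1 := by push_cast; ring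
  have e2 := inv_qPoch_mul_left hq h1 ((m : ℤ) - t)
  have e3 : m + 1 + t = m + t + 1 := by ring
  have a1 : u * v * q = q * u * v := by ring
  have a2 : q * u / v * q = q * (q * u) / v := by ring
  have a3 : q * u * v * q = q * (q * u) * v := by ring
  have a4 : q * (u / v) = q * u / v := by ring
  rw [pairFactor, pairFactor, neg_pow_succ_mul_choose, e1, e3, qp_succ', qp_succ',
    qp_succ' q (q * u * v), ← a2, e2, a2, a1, a3, a4]
  generalize (-(q * u / v)) ^ a * q ^ a.choose 2 = z
  generalize 1 - q * u / v = w1 at *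
  generalize 1 - q * u * v = w2 at *
  field_simp

lemma qp_mul_one_sub (q a : K) (n : ℕ) :
    qp q a n * (1 - a * q ^ n) = (1 - a) * qp q (a * q) n := by
  rw [← qp_succ, qp_succ']

/-- This covers the ordered pairs `(j, p)`. The change from `(v/u)_t` to `(q v/u)_t` depends on `t`;
the change of `pointFactor` compensates it, because the two pieces join to factorials of full length
`m`. -/
lemma pairFactor_shift_right {q u v : K} (hq : q ≠ 0) (hu : u ≠ 0)
    (h1 : ∀ k : ℕ, v / u * q ^ k ≠ 1) (h2 : q * u * v ≠ 1) {m t : ℕ} (htm : t ≤ m) (a : ℕ) :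
    pairFactor q v u m t (a + 1) * pointFactor q v m t (q * u) =
      q ^ m * (1 - v / u) ^ 2 / ((1 - q * u * v) * (1 - v / u * q ^ m)) *
        (pairFactor q v (q * u) m t a * pointFactor q v m t u) := by
  obtain ⟨d, rfl⟩ := Nat.exists_eq_add_of_le htm
  have h1' : 1 - v / u ≠ 0 := sub_ne_zero.2 (by simpa using (h1 0).symm)
  have h2' : 1 - q * u * v ≠ 0 := sub_ne_zero.2 h2.symm
  have h3 : 1 - v / u * q ^ (t + d) ≠ 0 := sub_ne_zero.2 (h1 _).symm
  have h4 : qp q (v / u) t ≠ 0 := qp_ne_zero fun k _ => h1 k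
  have h5 : qp q (v / u * q) t ≠ 0 := qp_ne_zero fun k _ => by
    rw [mul_assoc, ← pow_succ']; exact h1 (k + 1)
  have e1 : ((t + d : ℕ) : ℤ) - a = ((t + d : ℕ) : ℤ) - ((a + 1 : ℕ) : ℤ) + 1 := by push_cast; ring
  have e2 := inv_qPoch_mul_left hq (by simpa using h1 0) (((t + d : ℕ) : ℤ) - ((a + 1 : ℕ) : ℤ))
  have e3 := qp_mul_one_sub q (v / u) (t + d)
  have e4 : qpHom q (q * v * q ^ t) d (q * u) = (q * u) ^ d * qp q (v / u * q ^ t) d := by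
    rw [qpHom_eq (mul_ne_zero hq hu)]; congr 2; field_simp
  have e5 : qpHom q (q * v * q ^ t) d u = u ^ d * qp q (v / u * q * q ^ t) d := by
    rw [qpHom_eq hu]; congr 2; field_simp
  have a1 : q * v / u = v / u * q := by ring
  have a2 : q * v / (q * u) = v / u := by field_simp
  have a3 : q * v * (q * u) = q * v * u * q := by ring
  have a4 : v * (q * u) = q * u * v := by ring
  have a5 : q * v * u = q * u * v := by ring
  have a6 : v / (q * u) = v / u / q := by field_simp
  have a7 : u * v = v * u := by ring
  have e6 : (-(v / u)) ^ t = (-(v / u / q)) ^ t * q ^ t := by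
    rw [← mul_pow]; congr 1; field_simp
  rw [pairFactor, pairFactor, pointFactor, pointFactor, Nat.add_sub_cancel_left, e4, e5, a1, a2,
    e1, e2, a6, e6, ← add_assoc, qp_succ', a3, a4, a5, a7]
  rw [qp_add, qp_add] at e3
  generalize qp q (v / u * q ^ t) d = s1 at *
  generalize qp q (v / u * q * q ^ t) d = s2 at *
  generalize qp q (v / u) t = s3 at *
  generalize qp q (v / u * q) t = s4 at *
  generalize (-(v / u / q)) ^ t = z
  generalize qp q (q * u * v * q) (t + d + a) = z2
  generalize (qPoch q (v / u) (((t + d : ℕ) : ℤ) - ((a + 1 : ℕ) : ℤ) + 1))⁻¹ = z3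
  generalize 1 - q * u * v = w2 at *
  generalize 1 - v / u * q ^ (t + d) = w3 at *
  generalize 1 - v / u = w1 at *
  have e7 : s1 = w1 * s4 * s2 / (s3 * w3) := by
    rw [eq_div_iff (mul_ne_zero h4 h3)]; linear_combination e3
  rw [e7, mul_pow q u d, pow_add q t d]
  field_simp

/-- This covers the pair `(p, p)`. The quotient of `1 - u²` and `1 - q² u²` will cancel against the
corresponding one from `deltaC`. -/
lemma pairFactor_shift_diag {q u : K} (hq : q ≠ 0) (hu : u ≠ 0)
    (h1 : ∀ k : ℕ, q * q ^ k ≠ 1) (h2 : ∀ k : ℕ, u * u * q ^ k ≠ 1) {m a : ℕ} (ham : a ≤ m) :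
    pairFactor q u u (m + 1) (a + 1) (a + 1) * pointFactor q u (m + 1) (a + 1) (q * u) =
      (1 - u * u) / (1 - q * u * (q * u)) * (-q ^ m / (1 - q * q ^ m)) *
        (pairFactor q (q * u) (q * u) m a a * pointFactor q (q * u) m a u) := by
  obtain ⟨d, rfl⟩ := Nat.exists_eq_add_of_le ham
  have h3 : 1 - u * u ≠ 0 := sub_ne_zero.2 (by simpa using (h2 0).symm)
  have h4 : 1 - u * u * q ≠ 0 := sub_ne_zero.2 (by simpa using (h2 1).symm)
  have h5 : 1 - u * u * q * q ≠ 0 := sub_ne_zero.2 fun e => h2 2 (by rw [e]; ring)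
  have h6 : 1 - q * q ^ (a + d) ≠ 0 := sub_ne_zero.2 (h1 _).symm
  have h7 : qp q q a ≠ 0 := qp_ne_zero fun k _ => h1 k
  have h8 : qp q q (a + 1) ≠ 0 := qp_ne_zero fun k _ => h1 k
  have e1 : ((a + d + 1 : ℕ) : ℤ) - ((a + 1 : ℕ) : ℤ) = ((a + d : ℕ) : ℤ) - a := by
    push_cast; ring
  have e2 : a + d + 1 + (a + 1) = a + d + a + 1 + 1 := by ring
  have e3 := qp_succ q q (a + d)
  rw [show a + d + 1 = a + 1 + d by ring, qp_add q q a d, qp_add q q (a + 1) d] at e3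
  have e4 : qpHom q (q * u * q ^ (a + 1)) d (q * u) = (q * u) ^ d * qp q (q * q ^ a) d := by
    rw [qpHom_eq (mul_ne_zero hq hu)]; congr 2; field_simp; ring
  have e5 : qpHom q (q * (q * u) * q ^ a) d u = u ^ d * qp q (q * q ^ (a + 1)) d := by
    rw [qpHom_eq hu]; congr 2; field_simp; ring
  have a1 : q * u / u = q := by field_simp
  have a2 : q * (q * u) / (q * u) = q := by field_simp
  have a3 : q * u / (q * u) = 1 := div_self (mul_ne_zero hq hu)
  have a4 : q * u * (q * u) = u * u * q * q := by ring
  have a5 : q * u * u = u * u * q := by ring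
  have a6 : q * (q * u) * (q * u) = u * u * q * q * q := by ring
  have a7 : u * (q * u) = u * u * q := by ring
  have a8 : (-1 : K) ^ (a + 1) * q ^ (a + 1).choose 2 =
      -((-1) ^ a * q ^ a.choose 2) * q ^ a := by
    rw [neg_pow_succ_mul_choose, mul_one, neg_pow q, neg_pow (1 : K)]; ring
  rw [pairFactor, pairFactor, pointFactor, pointFactor, show a + d + 1 - (a + 1) = d by omega,
    Nat.add_sub_cancel_left, e4, e5, e1, e2, div_self hu, a1, a2, a3, a4, a5, a6, a7, a8,
    qp_succ' q (u * u), qp_succ' q (u * u * q), qp_succ' q (u * u * q), qp_succ' q (u * u * q * q)]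
  generalize qp q (q * q ^ a) d = s1 at *
  generalize qp q (q * q ^ (a + 1)) d = s2 at *
  generalize qp q q a = s3 at *
  generalize qp q q (a + 1) = s4 at *
  generalize (-1 : K) ^ a * q ^ a.choose 2 = z
  generalize qp q (u * u * q * q * q) (a + d + a) = z2
  generalize (qPoch q q (((a + d : ℕ) : ℤ) - a))⁻¹ = z3
  generalize qp q (u * u * q * q) a = z4
  generalize qp q (u * u * q) a = z5
  generalize 1 - u * u * q * q = w2 at *
  generalize 1 - u * u * q = w1 at *
  generalize 1 - u * u = w0 at *
  generalize 1 - q * q ^ (a + d) = w3 at *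
  have e7 : s2 = s3 * s1 * w3 / s4 := by
    rw [eq_div_iff h8]; linear_combination e3
  rw [e7, mul_pow q u d, pow_add q a d]
  field_simp

end Shift

/-! ### The `6φ5` summation -/

section SixPhiFive

variable {K : Type*} [Field K] {n : ℕ} {q : K} {x : Fin n → K}

/-- The `α`-sequence of the unit `C_n` Bailey pair. -/
def alphaSeq (q : K) (x : Fin n → K) (r : Fin n → ℕ) : K :=
  deltaC (fun i => x i * q ^ r i) / deltaC x *
    ∏ i, ∏ j, qp q (x i * x j) (r i) / qp q (q * x i / x j) (r i) *
      ((-(x i / x j)) ^ r i * q ^ (r i).choose 2)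

/-- The summand of the very-well-poised `C_n` series, with denominators depending on `b`
cleared and without the factors depending on `c`. -/
def clearedTerm (q : K) (x : Fin n → K) (N r : Fin n → ℕ) (b : K) : K :=
  alphaSeq q x r * (invA q x N r * invC q x N r) * (numProd q x r b * remProd q x N r b)

lemma clearedTerm_eq (q : K) (x : Fin n → K) (N r : Fin n → ℕ) (b : K) :
    clearedTerm q x N r b = deltaC (fun i => x i * q ^ r i) / deltaC x *
      (∏ i, ∏ j, pairFactor q (x i) (x j) (N i) (r i) (r j)) *
        ∏ i, pointFactor q (x i) (N i) (r i) b := by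
  simp only [clearedTerm, alphaSeq, invA, invC, numProd, remProd, pairFactor, pointFactor,
    Finset.prod_mul_distrib]
  ring

lemma Generic.deltaC_ne_zero (h : Generic q x) : deltaC x ≠ 0 := by
  refine mul_ne_zero (Finset.prod_ne_zero_iff.2 fun i _ => ?_)
    (Finset.prod_ne_zero_iff.2 fun i _ => Finset.prod_ne_zero_iff.2 fun j hj => mul_ne_zero ?_ ?_)
  · rw [pow_two, sub_ne_zero]; simpa using (h.mul_ne_one i i 0).symm
  · rw [sub_ne_zero]; simpa using h.q_pow_mul_ne i j (Finset.mem_Ioi.1 hj).ne 0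
  · rw [sub_ne_zero]; simpa using h.mul_ne_one i j 0

lemma deltaC_update (h : Generic q x) (p : Fin n) (u : K) :
    deltaC (Function.update x p u) / deltaC x = (1 - u * u) / (1 - x p * x p) *
      ∏ j ∈ Finset.univ.erase p,
        ((u - x j) * (u * x j - 1)) / ((x p - x j) * (x p * x j - 1)) := by
  have h1 : ∀ i, 1 - x i ^ 2 ≠ 0 := fun i => by
    rw [pow_two, sub_ne_zero]; simpa using (h.mul_ne_one i i 0).symm
  have h2 : ∀ i j, x i * x j - 1 ≠ 0 := fun i j => by
    rw [sub_ne_zero]; simpa using h.mul_ne_one i j 0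
  have h3 : ∀ i j, i ≠ j → x i - x j ≠ 0 := fun i j hij => by
    rw [sub_ne_zero]; simpa using h.q_pow_mul_ne i j hij 0
  rw [deltaC, deltaC, mul_div_mul_comm]
  congr 1
  · rw [← Finset.prod_div_distrib, ← Finset.mul_prod_erase _ _ (Finset.mem_univ p),
      Function.update_self, Finset.prod_eq_one, mul_one, pow_two, pow_two]
    intro i hi
    rw [Function.update_of_ne (Finset.ne_of_mem_erase hi), div_self (h1 i)]
  · simp only [← Finset.prod_div_distrib]
    -- `prod_Ioi_eq_prod_erase` asks for the value `1` also at `i = j ≠ p`, where the quotient is `0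
    -- / 0 = 0`; hence the `if`.
    have : ∀ i, ∀ j ∈ Finset.Ioi i,
        (Function.update x p u i - Function.update x p u j) *
          (Function.update x p u i * Function.update x p u j - 1) /
            ((x i - x j) * (x i * x j - 1)) =
        if i = j then 1 else (Function.update x p u i - Function.update x p u j) *
          (Function.update x p u i * Function.update x p u j - 1) /
            ((x i - x j) * (x i * x j - 1)) := fun i j hj => by
      rw [if_neg (Finset.mem_Ioi.1 hj).ne]
    rw [Finset.prod_congr rfl fun i _ => Finset.prod_congr rfl (this i),
      prod_Ioi_eq_prod_erase p]
    · refine Finset.prod_congr rfl fun j hj => ?_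
      have hj' := Finset.ne_of_mem_erase hj
      rw [if_neg hj'.symm, Function.update_self, Function.update_of_ne hj']
    · intro i j
      rcases eq_or_ne i j with rfl | hij
      · rfl
      rw [if_neg hij, if_neg hij.symm, ← neg_sub (Function.update x p u j), ← neg_sub (x j) (x i),
        mul_comm (x i), mul_comm (Function.update x p u i), neg_mul, neg_mul, neg_div_neg_eq]
    · intro i j hi hj
      split_ifs with hij
      · rfl
      rw [Function.update_of_ne hi, Function.update_of_ne hj]
      exact div_self (mul_ne_zero (h3 i j hij) (h2 i j))

/-- The factor relating the summands before and after the shift `x_p ↦ q x_p`. -/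
def shiftFactor (q : K) (x : Fin n → K) (N : Fin n → ℕ) (p : Fin n) : K :=
  -q ^ (N p - 1) / (1 - q ^ N p) * ∏ j ∈ Finset.univ.erase p,
    q ^ N j * (1 - x j / x p) /
      ((1 - x j / x p * q ^ N j) * (1 - q * x p / x j) * (1 - q * x p * x j))

lemma Generic.div_mul_ne_one (h : Generic q x) {i j : Fin n} (hij : i ≠ j) (k : ℕ) :
    x i / x j * q ^ k ≠ 1 := fun e => by
  have hj := h.x_ne_zero j
  refine h.q_pow_mul_ne i j hij k ?_
  field_simp at e
  linear_combination e

/-- The points `x_i q^{r_i}` are unchanged when `q` moves from the power into `x_p`, so of the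
Vandermonde quotient only the denominator changes. The point of the lemma is that `shiftFactor` does
not depend on `r`. -/
lemma clearedTerm_shift (h : Generic q x) {N r : Fin n → ℕ} {p : Fin n} {m a : ℕ}
    (hN : N p = m + 1) (hr : r p = a + 1) (hrN : r ≤ N) :
    clearedTerm q x N r (q * x p) = shiftFactor q x N p *
      clearedTerm q (Function.update x p (q * x p)) (Function.update N p m)
        (Function.update r p a) (x p) := by
  have hp := h.x_ne_zero p
  have hq := h.q_ne_zero
  set x' := Function.update x p (q * x p) with hx'
  have hz : (fun i => x' i * q ^ Function.update r p a i) = fun i => x i * q ^ r i := by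
    funext i
    rcases eq_or_ne i p with rfl | hi
    · rw [hx', Function.update_self, Function.update_self, hr]; ring
    · rw [hx', Function.update_of_ne hi, Function.update_of_ne hi]
  have hD' : deltaC (fun i => x i * q ^ r i) / deltaC x * deltaC x' =
      deltaC (fun i => x i * q ^ r i) * (deltaC x' / deltaC x) := by ring
  have hx'g : deltaC x' ≠ 0 := by
    intro e
    have e1 := deltaC_update h p (q * x p)
    rw [← hx', e, zero_div, eq_comm] at e1
    revert e1
    refine mul_ne_zero (div_ne_zero ?_ ?_) (Finset.prod_ne_zero_iff.2 fun j hj => ?_)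
    · rw [sub_ne_zero]
      exact fun e => h.mul_ne_one p p 2 (by rw [e]; ring)
    · rw [sub_ne_zero]
      simpa using (h.mul_ne_one p p 0).symm
    · have hj' := Finset.ne_of_mem_erase hj
      refine div_ne_zero (mul_ne_zero (sub_ne_zero.2 ?_) (sub_ne_zero.2 ?_))
        (mul_ne_zero (sub_ne_zero.2 ?_) (sub_ne_zero.2 ?_))
      · simpa using h.q_pow_mul_ne p j hj'.symm 1
      · simpa using h.q_pow_mul_mul_ne_one p j 1
      · simpa using h.q_pow_mul_ne p j hj'.symm 0
      · simpa using h.q_pow_mul_mul_ne_one p j 0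
  rw [clearedTerm_eq, clearedTerm_eq, hz,
    ← mul_div_cancel_right₀ (deltaC (fun i => x i * q ^ r i) / deltaC x) hx'g, hD',
    deltaC_update h p (q * x p), prod_prod_eq_mul_erase _ p,
    prod_prod_eq_mul_erase (fun i j => pairFactor q (x' i) (x' j) _ _ _) p,
    ← Finset.mul_prod_erase _ (fun i => pointFactor q (x i) (N i) (r i) (q * x p))
      (Finset.mem_univ p),
    ← Finset.mul_prod_erase _ (fun i => pointFactor q (x' i) _ _ (x p)) (Finset.mem_univ p),
    hx', Function.update_self, Function.update_self, Function.update_self, hN, hr, ← hx']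
  have hrest : ∏ i ∈ Finset.univ.erase p, ∏ j ∈ Finset.univ.erase p,
        pairFactor q (x' i) (x' j) (Function.update N p m i) (Function.update r p a i)
          (Function.update r p a j) =
      ∏ i ∈ Finset.univ.erase p, ∏ j ∈ Finset.univ.erase p,
        pairFactor q (x i) (x j) (N i) (r i) (r j) :=
    Finset.prod_congr rfl fun i hi => Finset.prod_congr rfl fun j hj => by
      have hi := Finset.ne_of_mem_erase hi
      have hj := Finset.ne_of_mem_erase hj
      rw [hx', Function.update_of_ne hi, Function.update_of_ne hj, Function.update_of_ne hi,
        Function.update_of_ne hi, Function.update_of_ne hj]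
  have ham : a ≤ m := by have : r p ≤ N p := hrN p; omega
  have hdiag := pairFactor_shift_diag hq hp (m := m) (a := a)
    (fun k => by rw [← pow_succ']; exact h.q_pow_ne_one _ (by omega))
    (fun k => h.mul_ne_one p p k) ham
  -- For each `j ≠ p`, the pairs `(p, j)` and `(j, p)`, the point factor of `x_j` and the
  -- Vandermonde factors of `{p, j}` are handled together.
  have hoff : (∏ j ∈ Finset.univ.erase p, (q * x p - x j) * (q * x p * x j - 1) /
        ((x p - x j) * (x p * x j - 1))) *
      (∏ j ∈ Finset.univ.erase p, pairFactor q (x p) (x j) (m + 1) (a + 1) (r j) *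
        pairFactor q (x j) (x p) (N j) (r j) (a + 1)) *
      (∏ j ∈ Finset.univ.erase p, pointFactor q (x j) (N j) (r j) (q * x p)) =
      (∏ j ∈ Finset.univ.erase p, q ^ N j * (1 - x j / x p) /
        ((1 - x j / x p * q ^ N j) * (1 - q * x p / x j) * (1 - q * x p * x j))) *
      (∏ j ∈ Finset.univ.erase p,
        pairFactor q (q * x p) (x' j) m a (Function.update r p a j) *
        pairFactor q (x' j) (q * x p) (Function.update N p m j) (Function.update r p a j) a) *
      (∏ j ∈ Finset.univ.erase p,
        pointFactor q (x' j) (Function.update N p m j) (Function.update r p a j) (x p)) := by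
    simp only [← Finset.prod_mul_distrib]
    refine Finset.prod_congr rfl fun j hj => ?_
    have hj := Finset.ne_of_mem_erase hj
    have hxj := h.x_ne_zero j
    rw [hx', Function.update_of_ne hj, Function.update_of_ne hj, Function.update_of_ne hj]
    have g1 : q * x p / x j ≠ 1 := by simpa using h.ratio_ne_one p j 0
    have g2 : q * x p * x j ≠ 1 := by simpa using h.q_pow_mul_mul_ne_one p j 1
    have g3 := h.div_mul_ne_one hj
    have k1 := pairFactor_shift_left hq g1 g2 m a (r j)
    have k2 := pairFactor_shift_right hq hp g3 g2 (hrN j) a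
    have f1 : 1 - q * x p / x j ≠ 0 := sub_ne_zero.2 g1.symm
    have f2 : 1 - q * x p * x j ≠ 0 := sub_ne_zero.2 g2.symm
    have f3 : 1 - x j / x p * q ^ N j ≠ 0 := sub_ne_zero.2 (g3 _).symm
    have f4 : 1 - x j / x p ≠ 0 := sub_ne_zero.2 (by simpa using (g3 0).symm)
    have f5 : 1 - x p * x j ≠ 0 :=
      sub_ne_zero.2 (by simpa using (h.q_pow_mul_mul_ne_one p j 0).symm)
    have c1 : q * x p - x j = -(x j * (1 - q * x p / x j)) := by field_simp; ring
    have c2 : x p - x j = x p * (1 - x j / x p) := by field_simp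
    have c3 : q * x p * x j - 1 = -(1 - q * x p * x j) := by ring
    have c4 : x p * x j - 1 = -(1 - x p * x j) := by ring
    rw [mul_assoc _ (_ * _), mul_assoc (pairFactor q (x p) _ _ _ _), k2, k1, c1, c2, c3, c4]
    generalize pairFactor q (q * x p) (x j) m a (r j) = z1
    generalize pairFactor q (x j) (q * x p) (N j) (r j) a = z2
    generalize 1 - q * x p / x j = w1 at *
    generalize 1 - q * x p * x j = w2 at *
    generalize 1 - x j / x p * q ^ N j = w3 at *
    generalize 1 - x j / x p = w4 at *
    generalize 1 - x p * x j = w5 at *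
    field_simp
  rw [hrest, shiftFactor, hN, Nat.add_sub_cancel]
  have f1 : 1 - x p * x p ≠ 0 :=
    sub_ne_zero.2 (by simpa using (h.mul_ne_one p p 0).symm)
  have f2 : 1 - q * x p * (q * x p) ≠ 0 :=
    sub_ne_zero.2 fun e => h.mul_ne_one p p 2 (by rw [e]; ring)
  have hd : (1 - q * x p * (q * x p)) / (1 - x p * x p) *
      (pairFactor q (x p) (x p) (m + 1) (a + 1) (a + 1) *
        pointFactor q (x p) (m + 1) (a + 1) (q * x p)) =
      -q ^ m / (1 - q ^ (m + 1)) * (pairFactor q (q * x p) (q * x p) m a a *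
        pointFactor q (q * x p) m a (x p)) := by
    rw [hdiag, ← pow_succ']
    generalize 1 - x p * x p = w1 at *
    generalize 1 - q * x p * (q * x p) = w2 at *
    field_simp
  linear_combination (deltaC (fun i => x i * q ^ r i) / deltaC x' *
    (∏ i ∈ Finset.univ.erase p, ∏ j ∈ Finset.univ.erase p,
        pairFactor q (x i) (x j) (N i) (r i) (r j))) * (congrArg₂ (· * ·) hd hoff)

lemma prod_eq_mul_prod_update (p : Fin n) {f g : Fin n → K} {t : K} (hp : f p = t * g p)
    (h : ∀ i, i ≠ p → f i = g i) : ∏ i, f i = t * ∏ i, g i := by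
  rw [← Finset.mul_prod_erase _ _ (Finset.mem_univ p),
    ← Finset.mul_prod_erase _ g (Finset.mem_univ p), hp, mul_assoc,
    Finset.prod_congr rfl fun i hi => h i (Finset.ne_of_mem_erase hi)]

lemma wtNum_shift {r : Fin n → ℕ} {p : Fin n} {a : ℕ} (hr : r p = a + 1) (c : K) :
    wtNum q x c r = (1 - c * x p) / c *
      wtNum q (Function.update x p (q * x p)) c (Function.update r p a) := by
  refine prod_eq_mul_prod_update p ?_ fun i hi => ?_
  · rw [Function.update_self, Function.update_self, hr, qp_succ', pow_succ]
    rw [show c * x p * q = c * (q * x p) by ring, div_mul_div_comm, mul_comm c (c ^ a)]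
  · rw [Function.update_of_ne hi, Function.update_of_ne hi]

lemma wtDen_shift {r : Fin n → ℕ} {p : Fin n} {a : ℕ} (hr : r p = a + 1) (c : K) :
    wtDen q x c r = (1 - q * x p / c) *
      wtDen q (Function.update x p (q * x p)) c (Function.update r p a) := by
  refine prod_eq_mul_prod_update p ?_ fun i hi => ?_
  · rw [Function.update_self, Function.update_self, hr, qp_succ']
    rw [show q * x p / c * q = q * (q * x p) / c by ring]
  · rw [Function.update_of_ne hi, Function.update_of_ne hi]

lemma size_eq_add_erase (r : Fin n → ℕ) (p : Fin n) :
    size r = r p + ∑ i ∈ Finset.univ.erase p, r i :=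
  (Finset.add_sum_erase _ _ (Finset.mem_univ p)).symm

lemma size_update (r : Fin n → ℕ) (p : Fin n) (a : ℕ) :
    size (Function.update r p a) = a + ∑ i ∈ Finset.univ.erase p, r i := by
  rw [size_eq_add_erase _ p, Function.update_self, Finset.sum_congr rfl fun i hi =>
    Function.update_of_ne (Finset.ne_of_mem_erase hi) ..]

lemma weightCoeff_shift {r : Fin n → ℕ} {p : Fin n} {a : ℕ} (hr : r p = a + 1) (c : K) :
    weightCoeff q x c r = (1 - c * x p) / c / (1 - q * x p / c) * q *
      weightCoeff q (Function.update x p (q * x p)) c (Function.update r p a) := by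
  rw [weightCoeff, weightCoeff, wtNum_shift hr, wtDen_shift hr, size_eq_add_erase r p, hr,
    size_update, mul_div_mul_comm, add_right_comm, pow_succ]
  ring

lemma invPairs_shift (h : Generic q x) {N : Fin n → ℕ} {p : Fin n} {m : ℕ} (hN : N p = m + 1)
    (h' : Generic q (Function.update x p (q * x p))) :
    invPairs q x N = (∏ j ∈ Finset.univ.erase p, (1 - q * x p * x j)⁻¹) *
      invPairs q (Function.update x p (q * x p)) (Function.update N p m) := by
  rw [← div_eq_iff (h'.invPairs_ne_zero _)]
  simp only [invPairs, ← Finset.prod_div_distrib]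
  rw [prod_Ioi_eq_prod_erase p]
  · refine Finset.prod_congr rfl fun j hj => ?_
    have hj := Finset.ne_of_mem_erase hj
    have h1 := h'.qp_mul_ne_zero' p j (m + N j)
    rw [Function.update_self, Function.update_of_ne hj] at h1
    rw [Function.update_self, Function.update_self, Function.update_of_ne hj,
      Function.update_of_ne hj, hN, add_right_comm, qp_succ',
      show q * x p * x j * q = q * (q * x p) * x j by ring, mul_inv, mul_div_assoc,
      div_self (inv_ne_zero h1), mul_one]
  · intro i j
    rw [mul_right_comm q (x i), add_comm (N i), mul_right_comm q (Function.update x p _ i),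
      add_comm (Function.update N p m i)]
  · intro i j hi hj
    rw [Function.update_of_ne hi, Function.update_of_ne hj, Function.update_of_ne hi,
      Function.update_of_ne hj]
    exact div_self (inv_ne_zero (h.qp_mul_ne_zero' i j _))

lemma invA_zero_shift (h : Generic q x) {N : Fin n → ℕ} {p : Fin n} {m : ℕ}
    (hN : N p = m + 1) :
    invA q x N 0 = (1 - q ^ (m + 1))⁻¹ * (∏ j ∈ Finset.univ.erase p, (1 - x j / x p) /
        ((1 - x j / x p * q ^ N j) * (1 - q * x p / x j))) *
      invA q (Function.update x p (q * x p)) (Function.update N p m) 0 := by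
  have hq := h.q_ne_zero
  have hp := h.x_ne_zero p
  simp only [invA, Pi.zero_apply, Nat.cast_zero, sub_zero, qPoch_natCast]
  rw [prod_prod_eq_mul_erase _ p, prod_prod_eq_mul_erase (fun i j => (qp q
    (q * Function.update x p (q * x p) i / Function.update x p (q * x p) j) _)⁻¹) p]
  have hrest : ∏ i ∈ Finset.univ.erase p, ∏ j ∈ Finset.univ.erase p,
      (qp q (q * Function.update x p (q * x p) i / Function.update x p (q * x p) j)
        (Function.update N p m i))⁻¹ =
      ∏ i ∈ Finset.univ.erase p, ∏ j ∈ Finset.univ.erase p, (qp q (q * x i / x j) (N i))⁻¹ :=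
    Finset.prod_congr rfl fun i hi => Finset.prod_congr rfl fun j hj => by
      have hi := Finset.ne_of_mem_erase hi
      have hj := Finset.ne_of_mem_erase hj
      rw [Function.update_of_ne hi, Function.update_of_ne hj, Function.update_of_ne hi]
  have hdiag : (qp q (q * x p / x p) (N p))⁻¹ = (1 - q ^ (m + 1))⁻¹ *
      (qp q (q * (q * x p) / (q * x p)) m)⁻¹ := by
    rw [mul_div_cancel_right₀ _ hp, mul_div_cancel_right₀ _ (mul_ne_zero hq hp), hN, qp_succ,
      mul_inv, ← pow_succ', mul_comm]
  have hoff : ∏ j ∈ Finset.univ.erase p,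
      ((qp q (q * x p / x j) (N p))⁻¹ * (qp q (q * x j / x p) (N j))⁻¹) =
      (∏ j ∈ Finset.univ.erase p, (1 - x j / x p) /
        ((1 - x j / x p * q ^ N j) * (1 - q * x p / x j))) *
      ∏ j ∈ Finset.univ.erase p,
        ((qp q (q * Function.update x p (q * x p) p / Function.update x p (q * x p) j)
          (Function.update N p m p))⁻¹ *
        (qp q (q * Function.update x p (q * x p) j / Function.update x p (q * x p) p)
          (Function.update N p m j))⁻¹) := by
    rw [← Finset.prod_mul_distrib]
    refine Finset.prod_congr rfl fun j hj => ?_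
    have hj := Finset.ne_of_mem_erase hj
    have hxj := h.x_ne_zero j
    rw [Function.update_self, Function.update_of_ne hj, Function.update_self,
      Function.update_of_ne hj, hN, qp_succ', show q * x p / x j * q = q * (q * x p) / x j by ring,
      show q * x j / x p = x j / x p * q by ring,
      show q * x j / (q * x p) = x j / x p by field_simp]
    have g3 := h.div_mul_ne_one hj
    have e := qp_mul_one_sub q (x j / x p) (N j)
    have f1 : qp q (x j / x p) (N j) ≠ 0 := qp_ne_zero fun k _ => g3 k
    have f2 : qp q (x j / x p * q) (N j) ≠ 0 := qp_ne_zero fun k _ => by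
      rw [mul_assoc, ← pow_succ']; exact g3 (k + 1)
    have f3 : 1 - x j / x p * q ^ N j ≠ 0 := sub_ne_zero.2 (g3 _).symm
    generalize qp q (x j / x p) (N j) = s1 at *
    generalize qp q (x j / x p * q) (N j) = s2 at *
    generalize 1 - x j / x p * q ^ N j = w3 at *
    have e' : s2⁻¹ = (1 - x j / x p) / w3 * s1⁻¹ := by
      rw [inv_eq_one_div, div_mul_eq_mul_div, eq_div_iff f3, ← div_eq_mul_inv, div_mul_eq_mul_div,
        div_eq_div_iff f2 f1]
      linear_combination e
    rw [e']
    generalize 1 - q * x p / x j = w1 at *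
    simp only [div_eq_mul_inv, mul_inv]
    ring
  rw [hrest, hdiag, hoff, Function.update_self, Function.update_self]
  ring

/-- After extracting `q` from each factor, the nodes are `y, q y, …, q^m y`; the first gives `u -
y`. -/
lemma qpHom_shift (q y u : K) (m : ℕ) :
    qpHom q (q * y) (m + 1) (q * u) = q ^ (m + 1) * (u - y) * qpHom q (q * y) m u := by
  rw [qpHom, qpHom, Finset.prod_range_succ', pow_succ]
  have : ∏ k ∈ Finset.range m, (q * u - q * y * q ^ (k + 1)) =
      q ^ m * ∏ k ∈ Finset.range m, (u - q * y * q ^ k) := by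
    have e := Finset.prod_const (s := Finset.range m) q
    rw [Finset.card_range] at e
    rw [← e, ← Finset.prod_mul_distrib]
    exact Finset.prod_congr rfl fun k _ => by ring
  rw [this]
  ring

/-- The closed form of the very-well-poised `C_n` series, with denominators depending on `b`
cleared. -/
def clearedSum (q : K) (x : Fin n → K) (c : K) (N : Fin n → ℕ) (b : K) : K :=
  invPairs q x N * invA q x N 0 / wtDen q x c N * qpHom q (q / c) (size N) b

/-- The multiplier is the product of those in `clearedTerm_shift` and `weightCoeff_shift`, so the
closed form transforms exactly as the series does. -/
lemma clearedSum_shift (h : Generic q x) {N : Fin n → ℕ} {p : Fin n} {m : ℕ} (hN : N p = m + 1)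
    (h' : Generic q (Function.update x p (q * x p))) {c : K} (hc : c ≠ 0) :
    clearedSum q x c N (q * x p) =
      shiftFactor q x N p * ((1 - c * x p) / c / (1 - q * x p / c) * q) *
        clearedSum q (Function.update x p (q * x p)) c (Function.update N p m) (x p) := by
  have e1 : size N = size (Function.update N p m) + 1 := by
    rw [size_eq_add_erase N p, size_update, hN]; ring
  have e2 : q ^ size (Function.update N p m) = q ^ m * ∏ j ∈ Finset.univ.erase p, q ^ N j := by
    rw [size_update, pow_add, Finset.prod_pow_eq_pow_sum]
  have e3 : shiftFactor q x N p = -q ^ m * (1 - q ^ (m + 1))⁻¹ *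
      ((∏ j ∈ Finset.univ.erase p, q ^ N j) * (∏ j ∈ Finset.univ.erase p, (1 - x j / x p) /
        ((1 - x j / x p * q ^ N j) * (1 - q * x p / x j))) *
        ∏ j ∈ Finset.univ.erase p, (1 - q * x p * x j)⁻¹) := by
    rw [shiftFactor, hN, Nat.add_sub_cancel, div_eq_mul_inv, ← Finset.prod_mul_distrib,
      ← Finset.prod_mul_distrib]
    congr 1
    refine Finset.prod_congr rfl fun j _ => ?_
    simp only [div_eq_mul_inv, mul_inv]
    ring
  rw [clearedSum, clearedSum, invPairs_shift h hN h', invA_zero_shift h hN, wtDen_shift hN, e1,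
    show q / c = q * c⁻¹ from div_eq_mul_inv _ _, qpHom_shift, e3, pow_succ q (size _), e2,
    show x p - c⁻¹ = -((1 - c * x p) / c) by field_simp; ring]
  simp only [div_eq_mul_inv, mul_inv]
  ring

lemma Generic.shift (h : Generic q x) (p : Fin n) :
    Generic q (Function.update x p (q * x p)) where
  q_ne_zero := h.q_ne_zero
  q_pow_ne_one := h.q_pow_ne_one
  x_ne_zero i := by
    rcases eq_or_ne i p with rfl | hi
    · rw [Function.update_self]; exact mul_ne_zero h.q_ne_zero (h.x_ne_zero _)
    · rw [Function.update_of_ne hi]; exact h.x_ne_zero i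
  q_pow_mul_ne i j hij k := by
    rcases eq_or_ne i p with rfl | hi
    · rw [Function.update_self, Function.update_of_ne hij.symm, ← mul_assoc, ← pow_succ]
      exact h.q_pow_mul_ne i j hij _
    rcases eq_or_ne j p with rfl | hj
    · rw [Function.update_self, Function.update_of_ne hi]
      -- For `k = 0`, the equation `x_i = q x_j` is excluded by genericity for the reversed pair
      -- `(j, i)`.
      rcases k with _ | k
      · rw [pow_zero, one_mul]
        exact fun e => h.q_pow_mul_ne j i hij.symm 1 (by rw [pow_one, e])
      · rw [pow_succ', mul_assoc]
        exact fun e => h.q_pow_mul_ne i j hij k (mul_left_cancel₀ h.q_ne_zero e)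
    · rw [Function.update_of_ne hi, Function.update_of_ne hj]
      exact h.q_pow_mul_ne i j hij k
  q_pow_mul_mul_ne_one i j k := by
    obtain ⟨l, hl⟩ : ∃ l : ℕ, Function.update x p (q * x p) i = q ^ l * x i := by
      rcases eq_or_ne i p with rfl | hi
      · exact ⟨1, by simp⟩
      · exact ⟨0, by simp [hi]⟩
    obtain ⟨l', hl'⟩ : ∃ l : ℕ, Function.update x p (q * x p) j = q ^ l * x j := by
      rcases eq_or_ne j p with rfl | hj
      · exact ⟨1, by simp⟩
      · exact ⟨0, by simp [hj]⟩
    rw [hl, hl']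
    intro e
    refine h.q_pow_mul_mul_ne_one i j (k + l + l') ?_
    rw [← e, pow_add, pow_add]; ring

lemma baileyKernel_zero_mul_remProd {N : Fin n → ℕ} {b : K}
    (hb : Admissible q x N b) (c : K) :
    baileyKernel q x b c N 0 * remProd q x N 0 b = clearedSum q x c N b := by
  have e1 : invPairs q x (0 : Fin n → ℕ) = 1 := by simp [invPairs]
  have e2 : diagA q x (0 : Fin n → ℕ) = 1 := by simp [diagA, qPoch]
  have e3 : size (0 : Fin n → ℕ) = 0 := by simp [size]
  rw [baileyKernel_mul_remProd zero_le hb, kernelCoeff, clearedSum, e1, e2, e3]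
  simp [wtNum, numProd]
  left
  ring

/-- The `C_n` analogue of the terminating `6φ5` summation. -/
theorem sum_alphaSeq (h : Generic q x) {c : K} (N : Fin n → ℕ) {b : K}
    (hb : Admissible q x N b) (hc : Admissible q x N c) :
    ∑ r ∈ Finset.Icc 0 N, alphaSeq q x r *
      (baileyWeight q x b c r * (invA q x N r * invC q x N r)) = baileyKernel q x b c N 0 := by
  -- Here `x` varies too, because the extra point uses the identity for the shifted variables.
  induction hm : size N using Nat.strong_induction_on generalizing x N b with
  | _ m ih =>
  subst hm
  have hclear : ∀ (x : Fin n → K) (N : Fin n → ℕ) (b : K), Admissible q x N b →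
      (∑ r ∈ Finset.Icc 0 N, alphaSeq q x r *
        (baileyWeight q x b c r * (invA q x N r * invC q x N r))) * remProd q x N 0 b =
      ∑ r ∈ Finset.Icc 0 N, weightCoeff q x c r * clearedTerm q x N r b := by
    intro x N b hb
    rw [Finset.sum_mul]
    refine Finset.sum_congr rfl fun r hr => ?_
    rw [clearedTerm]
    linear_combination alphaSeq q x r * (invA q x N r * invC q x N r) *
      baileyWeight_mul_remProd (Finset.mem_Icc.1 hr).2 hb c
  by_cases hN : ∀ i, N i = 0
  · obtain rfl : N = 0 := funext hN
    simp [alphaSeq, baileyWeight, baileyKernel, invA, invC, invPairs, diagA, wtNum, wtDen, size,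
      qPoch, div_self h.deltaC_ne_zero]
  push Not at hN
  obtain ⟨p, hp⟩ := hN
  obtain ⟨m, hpm⟩ := Nat.exists_eq_succ_of_ne_zero hp
  refine mul_right_cancel₀ hb.remProd_ne_zero ?_
  rw [hclear x N b hb, baileyKernel_zero_mul_remProd hb]
  -- This point is never admissible, since `(q x_p/b)_{N_p} = (1)_{N_p} = 0`; only the cleared
  -- identity makes sense there.
  refine eq_of_interpolation (e := q * x p) h
    (f := fun b => ∑ r ∈ Finset.Icc 0 N, weightCoeff q x c r * clearedTerm q x N r b)
    (g := clearedSum q x c N) (IsPolyFun.sum fun r hr => ?_)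
    ((isPolyFun_qpHom q _ _).const_mul _) ?_ ?_ ?_ b
  · exact ((isPolyFun_weight (Finset.mem_Icc.1 hr).2).const_mul _).const_mul _
  · intro p k hk b hb
    have hbN := h.admissible_inv hb N
    obtain ⟨d, hd⟩ := Nat.exists_eq_add_of_le hk.le
    have hb' : (x p * q ^ (k + d))⁻¹ * (x p * q ^ (k + d)) = 1 := inv_mul_cancel₀
      (mul_ne_zero (h.x_ne_zero p) (pow_ne_zero _ h.q_ne_zero))
    have hle := update_le hk.le
    have key := ih _ (size_update_lt hk) h (Function.update N p k) (h.admissible_inv hb' _)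
      (hc.mono hle) rfl
    rw [← hclear x N b hbN, ← baileyKernel_zero_mul_remProd hbN]
    congr 1
    refine mul_right_cancel₀ (h.stepFactor_ne_zero p k d) ?_
    rw [baileyKernel_update h hd hb hb' hc zero_le, ← key, sum_Icc_update hk.le, Finset.sum_mul]
    · refine Finset.sum_congr rfl fun r _ => ?_
      rw [← baileyWeight_update h hd hb hb', mul_assoc]
    · intro r hr hr'
      simp [baileyWeight, wtNum_eq_zero hb hr hr']
  · intro p' k hk e
    exact h.mul_ne_one p p' (k + 1) (by rw [← e, pow_succ]; ring)
  · have h' := h.shift p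
    have hb' : Admissible q (Function.update x p (q * x p)) (Function.update N p m) (x p) := by
      refine ⟨h.x_ne_zero p, fun i k _ => ?_⟩
      rcases eq_or_ne i p with rfl | hi
      · rw [Function.update_self, ← mul_assoc, ← pow_succ]
        exact fun e => h.q_pow_ne_one (k + 2) (by omega)
          (mul_right_cancel₀ (h.x_ne_zero i) (by rw [e, one_mul]))
      · rw [Function.update_of_ne hi]
        exact h.q_pow_mul_ne i p hi _
    have hc' : Admissible q (Function.update x p (q * x p)) (Function.update N p m) c := by
      refine ⟨hc.1, fun i k hk => ?_⟩
      rcases eq_or_ne i p with rfl | hi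
      · rw [Function.update_self] at hk ⊢
        rw [← mul_assoc, ← pow_succ]
        exact hc.2 i (k + 1) (by omega)
      · rw [Function.update_of_ne hi] at hk ⊢
        exact hc.2 i k hk
    have key := ih _ (size_update_lt (by omega)) h' (Function.update N p m) hb' hc' rfl
    have key' := hclear _ _ _ hb'
    rw [key, baileyKernel_zero_mul_remProd hb'] at key'
    -- Terms with `r_p = 0` drop out, as `remProd` then contains `b - q x_p = 0`. The remaining `r`
    -- are matched with the shifted series by `r_p ↦ r_p - 1`.
    rw [clearedSum_shift h hpm h' hc.1, key', Finset.mul_sum,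
      ← Finset.sum_filter_of_ne (p := fun r : Fin n → ℕ => r p ≠ 0)]
    · refine Finset.sum_nbij' (fun r => Function.update r p (r p - 1))
        (fun r => Function.update r p (r p + 1)) ?_ ?_ ?_ ?_ ?_
      · intro r hr
        obtain ⟨hr, hrp⟩ := Finset.mem_filter.1 hr
        have hrN := (Finset.mem_Icc.1 hr).2
        have hrNp : r p ≤ N p := hrN p
        refine Finset.mem_Icc.2 ⟨zero_le, fun i => ?_⟩
        rcases eq_or_ne i p with rfl | hi
        · rw [Function.update_self, Function.update_self]
          exact Nat.sub_le_of_le_add (by omega)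
        · rw [Function.update_of_ne hi, Function.update_of_ne hi]; exact hrN i
      · intro r hr
        have hrN := (Finset.mem_Icc.1 hr).2
        refine Finset.mem_filter.2 ⟨Finset.mem_Icc.2 ⟨zero_le, fun i => ?_⟩, by simp⟩
        have hi' := hrN i
        rcases eq_or_ne i p with rfl | hi
        · rw [Function.update_self] at hi' ⊢
          rw [hpm]
          exact Nat.succ_le_succ hi'
        · rw [Function.update_of_ne hi] at hi' ⊢; exact hi'
      · intro r hr
        have hrp := (Finset.mem_filter.1 hr).2
        simp [Nat.sub_add_cancel (Nat.one_le_iff_ne_zero.2 hrp)]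
      · intro r _
        simp
      · intro r hr
        obtain ⟨hr, hrp⟩ := Finset.mem_filter.1 hr
        obtain ⟨a, ha⟩ := Nat.exists_eq_succ_of_ne_zero hrp
        rw [clearedTerm_shift h hpm ha (Finset.mem_Icc.1 hr).2, weightCoeff_shift ha, ha,
          Nat.succ_sub_one]
        ring
    · intro r _ hne hrp
      refine hne ?_
      have : remProd q x N r (q * x p) = 0 := Finset.prod_eq_zero (Finset.mem_univ p)
        (Finset.prod_eq_zero (Finset.mem_range.2 (by rw [hrp]; omega : 0 < N p - r p))
          (by simp [hrp]))
      simp [clearedTerm, this]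

end SixPhiFive

/-! ### Iterating the Bailey lemma along a chain of indices -/

section Iteration

variable {K : Type*} [Field K] {n m : ℕ} {q : K} {x : Fin n → K}

/-- The factor of the multisum that links two consecutive summation indices. -/
def linkFactor (q : K) (x : Fin n → K) (b c : K) (r s : Fin n → ℕ) : K :=
  qPoch q (q / (b * c)) ((size r : ℤ) - size s) * (q / (b * c)) ^ size s *
    ∏ i, qPoch q (b * x i) (s i) * qPoch q (c * x i) (s i) /
      (qPoch q (q * x i / b) (r i) * qPoch q (q * x i / c) (r i))

/-- The summand of the multisum, normalised so as to be multiplicative in `baileyKernel`. -/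
def normTerm (q : K) (x : Fin n → K) (b c : Fin (m + 1) → K) (N : Fin n → ℕ)
    (r : Fin m → Fin n → ℕ) : K :=
  invPairs q x N * invA q x N (extendSeq N r 1) *
    (∏ l : Fin m, diagA q x (extendSeq N r l.succ.castSucc) *
      invA q x (extendSeq N r l.succ.castSucc) (extendSeq N r l.succ.succ)) *
    ∏ l : Fin (m + 1),
      linkFactor q x (b l) (c l) (extendSeq N r l.castSucc) (extendSeq N r l.succ)

lemma pow_size (a : K) (r : Fin n → ℕ) : ∏ i, a ^ r i = a ^ size r :=
  Finset.prod_pow_eq_pow_sum ..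

lemma linkFactor_eq (b c : K) (r s : Fin n → ℕ) :
    linkFactor q x b c r s = qPoch q (q / (b * c)) ((size r : ℤ) - size s) * q ^ size s *
      (wtNum q x b s * wtNum q x c s / (wtDen q x b r * wtDen q x c r)) := by
  simp only [linkFactor, wtNum, wtDen, qPoch_natCast, Finset.prod_div_distrib,
    Finset.prod_mul_distrib, pow_size, div_pow, mul_pow]
  simp only [div_eq_mul_inv, mul_inv]
  ring

/-- This form exhibits the telescoping of `invPairs` along a chain; at the end `s = 0` it equals
`1`. -/
lemma baileyKernel_mul_invPairs (h : Generic q x) (b c : K) (N s : Fin n → ℕ) :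
    baileyKernel q x b c N s * invPairs q x s =
      invPairs q x N * invA q x N s * diagA q x s * linkFactor q x b c N s := by
  have h1 := h.invPairs_ne_zero s
  rw [linkFactor_eq, baileyKernel]
  generalize wtNum q x b s * wtNum q x c s / (wtDen q x b N * wtDen q x c N) = z
  field_simp

lemma hypTerm_zero (r s : Fin n → ℕ) : hypTerm q x 0 r s = diagA q x r * invA q x r s := by
  simp [hypTerm, diagA, invA, Finset.prod_mul_distrib, div_eq_mul_inv]

lemma andrewsTerm_mul_invPairs (b c : Fin (m + 1) → K) (N : Fin n → ℕ)
    (r : Fin m → Fin n → ℕ) : andrewsTerm q x b c N r * invPairs q x N =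
      (∏ i, ∏ j, qp q (q * x i / x j) (N i)) * normTerm q x b c N r := by
  simp only [andrewsTerm, normTerm, hypTerm_zero, linkFactor, invA, div_eq_mul_inv, qPoch_natCast,
    Finset.prod_mul_distrib]
  ring

lemma extendSeq_cons (N s : Fin n → ℕ) (r : Fin m → Fin n → ℕ) :
    extendSeq N (Fin.cons (α := fun _ => Fin n → ℕ) s r) =
      Fin.cons (α := fun _ => Fin n → ℕ) N (extendSeq s r) := by
  rw [extendSeq, extendSeq, ← Fin.cons_snoc_eq_snoc_cons]

lemma extendSeq_zero (N : Fin n → ℕ) (r : Fin m → Fin n → ℕ) : extendSeq N r 0 = N := rfl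

lemma normTerm_cons (h : Generic q x) (b c : Fin (m + 2) → K) (N s : Fin n → ℕ)
    (r : Fin m → Fin n → ℕ) :
    normTerm q x b c N (Fin.cons (α := fun _ => Fin n → ℕ) s r) =
      baileyKernel q x (b 0) (c 0) N s *
        normTerm q x (fun l => b l.succ) (fun l => c l.succ) s r := by
  have h0 : extendSeq N (Fin.cons (α := fun _ => Fin n → ℕ) s r) 1 = s := by
    rw [extendSeq_cons]; rfl
  have h1 : ∀ l : Fin (m + 2), extendSeq N (Fin.cons (α := fun _ => Fin n → ℕ) s r) l.succ =
      extendSeq s r l := fun l => by rw [extendSeq_cons]; rfl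
  have h2 : ∀ l : Fin (m + 1), extendSeq N (Fin.cons (α := fun _ => Fin n → ℕ) s r)
      l.succ.castSucc = extendSeq s r l.castSucc := fun l => by rw [extendSeq_cons]; rfl
  have h3 : extendSeq N (Fin.cons (α := fun _ => Fin n → ℕ) s r) (Fin.castSucc 1) = s := by
    rw [extendSeq_cons]; rfl
  have e := baileyKernel_mul_invPairs h (b 0) (c 0) N s
  rw [normTerm, normTerm, Fin.prod_univ_succ, Fin.prod_univ_succ (n := m + 1)]
  simp only [h0, h1, h2, h3, Fin.castSucc_zero, extendSeq_zero, Fin.succ_zero_eq_one]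
  linear_combination -(invA q x s (extendSeq s r 1) *
    (∏ l : Fin m, diagA q x (extendSeq s r l.succ.castSucc) *
      invA q x (extendSeq s r l.succ.castSucc) (extendSeq s r l.succ.succ)) *
    ∏ l : Fin (m + 1), linkFactor q x (b l.succ) (c l.succ) (extendSeq s r l.castSucc)
      (extendSeq s r l.succ)) * e

lemma normTerm_zero (h : Generic q x) (b c : Fin 1 → K) (N : Fin n → ℕ)
    (r : Fin 0 → Fin n → ℕ) : normTerm q x b c N r = baileyKernel q x (b 0) (c 0) N 0 := by
  have e := baileyKernel_mul_invPairs h (b 0) (c 0) N 0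
  have e1 : invPairs q x (0 : Fin n → ℕ) = 1 := by simp [invPairs]
  have e2 : diagA q x (0 : Fin n → ℕ) = 1 := by simp [diagA, qPoch]
  have e3 : extendSeq N r 1 = 0 := rfl
  rw [e1, mul_one, e2, mul_one] at e
  rw [e, normTerm]
  simp [e3, extendSeq_zero]

/-- A nonzero term has no vanishing kernel, so its indices decrease along the chain starting at `N`.
This yields the finite support. -/
lemma le_of_normTerm_ne_zero (h : Generic q x) {b c : Fin (m + 1) → K} {N : Fin n → ℕ}
    {r : Fin m → Fin n → ℕ} (hne : normTerm q x b c N r ≠ 0) (l : Fin m) : r l ≤ N := by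
  induction m generalizing N with
  | zero => exact l.elim0
  | succ m ih =>
    rw [← Fin.cons_self_tail r, normTerm_cons h] at hne
    have h1 : r 0 ≤ N := by
      by_contra hle
      exact left_ne_zero_of_mul hne (h.baileyKernel_eq_zero hle _ _)
    refine Fin.cases h1 (fun l => ?_) l
    exact (ih (right_ne_zero_of_mul hne) l).trans h1

lemma sum_piFinset_succ {ι : Type*} [DecidableEq ι] (s : Finset ι) (F : (Fin (m + 1) → ι) → K) :
    ∑ r ∈ Fintype.piFinset fun _ : Fin (m + 1) => s, F r =
      ∑ a ∈ s, ∑ r ∈ Fintype.piFinset fun _ : Fin m => s, F (Fin.cons (α := fun _ => ι) a r) := by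
  rw [← Finset.sum_product']
  refine Finset.sum_nbij' (fun r => (r 0, Fin.tail r))
    (fun y => Fin.cons (α := fun _ => ι) y.1 y.2) ?_ ?_ ?_ ?_ ?_
  · intro r hr
    rw [Fintype.mem_piFinset] at hr
    exact Finset.mem_product.2 ⟨hr 0, Fintype.mem_piFinset.2 fun l => hr l.succ⟩
  · intro y hy
    obtain ⟨h1, h2⟩ := Finset.mem_product.1 hy
    exact Fintype.mem_piFinset.2 fun l => Fin.cases h1 (Fintype.mem_piFinset.1 h2) l
  · intro r _
    exact Fin.cons_self_tail r
  · intro y _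
    rfl
  · intro r _
    simp only [Fin.cons_self_tail]

/-- The normalised Andrews transformation. -/
theorem sum_normTerm (h : Generic q x) {b c : Fin (m + 1) → K} {N : Fin n → ℕ}
    (hb : ∀ l, Admissible q x N (b l)) (hc : ∀ l, Admissible q x N (c l)) :
    ∑ r ∈ Fintype.piFinset fun _ : Fin m => Finset.Icc 0 N, normTerm q x b c N r =
      ∑ s ∈ Finset.Icc 0 N, alphaSeq q x s * (∏ l, baileyWeight q x (b l) (c l) s) *
        (invA q x N s * invC q x N s) := by
  induction m generalizing N with
  | zero =>
    have := sum_alphaSeq h N (hb 0) (hc 0)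
    rw [Finset.sum_congr rfl fun r _ => normTerm_zero h b c N r]
    simp only [Finset.sum_const, Fintype.card_piFinset, Finset.univ_eq_empty, Finset.prod_empty,
      one_smul, ← this, Fin.prod_univ_succ, mul_one, mul_assoc]
  | succ m ih =>
    rw [sum_piFinset_succ]
    -- The box for the later indices shrinks to `[0, s]` so that the induction hypothesis applies
    -- with `s` for `N`. The sum over `t` is then extended back to `[0, N]`, where `invA s t`
    -- vanishes unless `t ≤ s`, so that the two sums can be exchanged.
    have h1 : ∀ s ∈ Finset.Icc 0 N, ∑ r ∈ Fintype.piFinset fun _ : Fin m => Finset.Icc 0 N,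
        normTerm q x b c N (Fin.cons (α := fun _ => Fin n → ℕ) s r) =
        ∑ t ∈ Finset.Icc 0 N, alphaSeq q x t *
          (∏ l : Fin (m + 1), baileyWeight q x (b l.succ) (c l.succ) t) *
          (baileyKernel q x (b 0) (c 0) N s * (invA q x s t * invC q x s t)) := by
      intro s hs
      have hsN := (Finset.mem_Icc.1 hs).2
      have hsub : Finset.Icc 0 s ⊆ Finset.Icc 0 N := Finset.Icc_subset_Icc le_rfl hsN
      rw [Finset.sum_congr rfl fun r _ => normTerm_cons h b c N s r, ← Finset.mul_sum,
        ← Finset.sum_subset (Fintype.piFinset_subset _ _ fun _ => hsub),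
        ih (fun l => (hb l.succ).mono hsN) (fun l => (hc l.succ).mono hsN), Finset.mul_sum,
        Finset.sum_subset hsub]
      · exact Finset.sum_congr rfl fun t _ => by ring
      · intro t _ ht
        rw [h.invA_eq_zero fun hle => ht (Finset.mem_Icc.2 ⟨zero_le, hle⟩)]
        simp
      · intro r _ hr
        by_contra hne
        exact hr (Fintype.mem_piFinset.2 fun l =>
          Finset.mem_Icc.2 ⟨zero_le, le_of_normTerm_ne_zero h hne l⟩)
    rw [Finset.sum_congr rfl h1, Finset.sum_comm]
    refine Finset.sum_congr rfl fun t _ => ?_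
    rw [← Finset.mul_sum, sum_baileyKernel h t N (hb 0) (hc 0), Fin.prod_univ_succ (n := m + 1)]
    ring

/-- Reversal turns `(q^{-N_j} x_i/x_j)_{r_i}` into a quotient of factorials in `q x_j/x_i`, and its
powers supply the sign and `q`-power of `alphaSeq`. The matrix entries appear with `i` and `j`
interchanged, which the product over all pairs undoes. -/
lemma qp_mul_q_pow (h : Generic q x) (N r : Fin n → ℕ) (i j : Fin n) :
    qp q (q ^ (-(N j : ℤ)) * x i / x j) (r i) * qp q (x i * x j) (r i) /
        (qp q (q * x i / x j) (r i) * qp q (q ^ (N j + 1) * x i * x j) (r i)) * q ^ (N j * r i) =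
      qp q (x i * x j) (r i) / qp q (q * x i / x j) (r i) *
          ((-(x i / x j)) ^ r i * q ^ (r i).choose 2) *
        (qp q (q * x j / x i) (N j) * qp q (q * x j * x i) (N j) *
          ((qPoch q (q * x j / x i) ((N j : ℤ) - r i))⁻¹ *
            (qp q (q * x j * x i) (N j + r i))⁻¹)) := by
  have hq := h.q_ne_zero
  have hi := h.x_ne_zero i
  have hj := h.x_ne_zero j
  have e1 := qp_reverse hq (div_ne_zero hi hj) (N j) (r i)
    (b := q ^ (-(N j : ℤ)) * x i / x j) (by
      rw [zpow_neg, zpow_natCast]; field_simp)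
  rw [show q * (x i / x j)⁻¹ = q * x j / x i by field_simp] at e1
  have e2 := inv_qPoch_add hq (h.ratio_ne_one j i) ((N j : ℤ) - r i) (r i)
  rw [sub_add_cancel, qPoch_natCast] at e2
  have h1 := h.qp_ratio_ne_zero' j i (N j)
  have h2 := h.qp_mul_ne_zero' j i (N j)
  have h3 := h.qp_mul_ne_zero j i (N j) (r i)
  rw [e2, qp_add, show q ^ (N j + 1) * x i * x j = q * x j * x i * q ^ N j by ring]
  rw [div_mul_eq_mul_div, mul_right_comm, e1]
  generalize qp q (q * x j * x i * q ^ N j) (r i) = w1 at *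
  generalize qp q (q * x j * x i) (N j) = w2 at *
  generalize qp q (q * x j / x i) (N j) = w3 at *
  field_simp

lemma andrewsLHS_eq (h : Generic q x) (b c : Fin (m + 1) → K) (N : Fin n → ℕ) :
    andrewsLHS q x b c N = (∏ i, ∏ j, qp q (q * x i * x j) (N i)) *
      ((∏ i, ∏ j, qp q (q * x i / x j) (N i)) *
        ∑ s ∈ Finset.Icc 0 N, alphaSeq q x s * (∏ l, baileyWeight q x (b l) (c l) s) *
          (invA q x N s * invC q x N s)) := by
  rw [andrewsLHS, Finset.mul_sum, Finset.mul_sum]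
  refine Finset.sum_congr rfl fun r _ => ?_
  simp only [qPoch_natCast]
  simp only [qp_mul_q_pow h N r]
  have e1 : ∏ i, ∏ l, qp q (b l * x i) (r i) * qp q (c l * x i) (r i) /
      (qp q (q * x i / b l) (r i) * qp q (q * x i / c l) (r i)) * (q / (b l * c l)) ^ r i =
      ∏ l, baileyWeight q x (b l) (c l) r := by
    rw [Finset.prod_comm]
    refine Finset.prod_congr rfl fun l _ => ?_
    simp only [baileyWeight, wtNum, wtDen, Finset.prod_div_distrib, Finset.prod_mul_distrib,
      pow_size, div_pow, mul_pow]
    simp only [div_eq_mul_inv, mul_inv]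
    ring
  have e2 : ∏ i, ∏ j, qp q (q * x j / x i) (N j) * qp q (q * x j * x i) (N j) *
      ((qPoch q (q * x j / x i) ((N j : ℤ) - r i))⁻¹ * (qp q (q * x j * x i) (N j + r i))⁻¹) =
      (∏ i, ∏ j, qp q (q * x i / x j) (N i)) * (∏ i, ∏ j, qp q (q * x i * x j) (N i)) *
        (invA q x N r * invC q x N r) := by
    rw [Finset.prod_comm]
    simp only [invA, invC, Finset.prod_mul_distrib]
  rw [Finset.prod_mul_distrib, e1, alphaSeq]
  simp only [Finset.prod_mul_distrib] at e2 ⊢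
  linear_combination (deltaC (fun i => x i * q ^ r i) / deltaC x *
    (∏ l, baileyWeight q x (b l) (c l) r) *
    ((∏ i, ∏ j, qp q (x i * x j) (r i) / qp q (q * x i / x j) (r i)) *
      ((∏ i, ∏ j, (-(x i / x j)) ^ r i) * ∏ i, ∏ _j : Fin n, q ^ (r i).choose 2))) * e2

end Iteration

theorem mainTheorem4 {K : Type*} [Field K] (n m : ℕ) (N : Fin n → ℕ)
    (q : K) (x : Fin n → K) (b c : Fin (m + 1) → K)
    (hq : q ≠ 0) (hq1 : ∀ k : ℕ, 1 ≤ k → q ^ k ≠ 1)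
    (hx : ∀ i, x i ≠ 0) (hb : ∀ l, b l ≠ 0) (hc : ∀ l, c l ≠ 0)
    (hxx : ∀ i j, i ≠ j → ∀ k : ℕ, q ^ k * x i ≠ x j)
    (hxx' : ∀ i j, ∀ k : ℕ, q ^ k * x i * x j ≠ 1)
    (hxb : ∀ i l, ∀ k : ℕ, 1 ≤ k → k ≤ N i → q ^ k * x i ≠ b l)
    (hxc : ∀ i l, ∀ k : ℕ, 1 ≤ k → k ≤ N i → q ^ k * x i ≠ c l) :
    (Function.support fun r : Fin m → Fin n → ℕ => andrewsTerm q x b c N r).Finite ∧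
      andrewsLHS q x b c N =
        andrewsPrefactor q x N * ∑ᶠ r : Fin m → Fin n → ℕ, andrewsTerm q x b c N r := by
  have h : Generic q x := ⟨hq, hq1, hx, hxx, hxx'⟩
  have hb' : ∀ l, Admissible q x N (b l) := fun l =>
    ⟨hb l, fun i k hk => hxb i l (k + 1) (by omega) (by omega)⟩
  have hc' : ∀ l, Admissible q x N (c l) := fun l =>
    ⟨hc l, fun i k hk => hxc i l (k + 1) (by omega) (by omega)⟩
  -- As `invPairs N` is nonzero, a nonzero multisum term forces a nonzero `normTerm`.
  have hsub : (Function.support fun r : Fin m → Fin n → ℕ => andrewsTerm q x b c N r) ⊆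
      ↑(Fintype.piFinset fun _ : Fin m => Finset.Icc 0 N) := by
    intro r hr
    refine Finset.mem_coe.2 (Fintype.mem_piFinset.2 fun l => Finset.mem_Icc.2 ⟨zero_le, ?_⟩)
    refine le_of_normTerm_ne_zero h (b := b) (c := c) (fun e => ?_) l
    have := andrewsTerm_mul_invPairs (q := q) (x := x) b c N r
    rw [e, mul_zero] at this
    exact mul_ne_zero hr (h.invPairs_ne_zero N) this
  refine ⟨(Finset.finite_toSet _).subset hsub, ?_⟩
  have hpre : andrewsPrefactor q x N =
      (∏ i, ∏ j, qp q (q * x i * x j) (N i)) * invPairs q x N := by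
    simp only [andrewsPrefactor, invPairs, one_div, ← Nat.cast_add, qPoch_natCast]
  rw [finsum_eq_sum_of_support_subset _ hsub, hpre, andrewsLHS_eq h, ← sum_normTerm h hb' hc',
    mul_assoc, Finset.mul_sum, Finset.mul_sum (a := invPairs q x N)]
  congr 1
  refine Finset.sum_congr rfl fun r _ => ?_
  rw [← andrewsTerm_mul_invPairs, mul_comm]
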